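/- **Setting.** Let $(X,d_X)$, $(Y,d_Y)$ be complete metric spaces, $Z=X\times Y$ with $d_Z^2((x,y),(x',y'))=d_X^2(x,x')+d_Y^2(y,y')$, and let $\phi\colon X\times Y\to[-\infty,+\infty]$. Put $D_X=\{x:\phi(x,y)<+\infty\ \forall y\in Y\}$, $D_Y=\{y:\phi(x,y)>-\infty\ \forall x\in X\}$, $D=D_X\times D_Y$. Assume that: - $\phi$ is proper: $D\neq\emptyset$; - $\phi$ is closed: $\phi(x,\cdot)$ is upper semicontinuous on $Y$ for every $x\in D_X$, and $\phi(\cdot,y)$ is lower semicontinuous on $X$ for every $y\in D_Y$; - $\phi=+\infty$ on $D_X^c\times D_Y$ and $\phi=-\infty$ on $D_X\times D_Y^c$. A function $\varphi\colon X\times Y\to\mathbb R$ is a *coupling term* of $\phi$ if there are a lower semicontinuous $\psi_X\colon X\to(-\infty,+\infty]$ and an upper semicontinuous $\psi_Y\colon Y\to[-\infty,+\infty)$ with $\phi(x,y)=\varphi(x,y)+\psi_X(x)+\psi_Y(y)$ for all $(x,y)\in D$. Let $\lambda\in\mathbb R$. A *solution of* $\mathrm{EVIs}_\lambda$ is a continuous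 curve $w=(u,v)\colon(0,+\infty)\to D$ such that for all $t>0$ and $(x,y)\in D$ $$\tfrac12\tfrac{d}{dt}^{+}d_X^2(u_t,x)+\tfrac\lambda2d_X^2(u_t,x)+\phi(u_t,v_t)\le\phi(x,v_t),$$ $$\tfrac12\tfrac{d}{dt}^{+}d_Y^2(v_t,y)+\tfrac\lambda2d_Y^2(v_t,y)+\phi(u_t,y)\le\phi(u_t,v_t),$$ where $\frac{d}{dt}^{+}f(t)=\limsup_{h\downarrow0}\frac{f(t+h)-f(t)}h\in[-\infty,+\infty]$. If $\lim_{t\downarrow0}w_t$ exists in $Z$, it is denoted by $w_0$; below, statements involving time $0$ are made for those solutions for which this limit exists. For $z=(x,y)\in D$ let $$|\partial\phi|(z)=\limsup_{D\ni z'=(x',y')\to z,\ z'\ne z}\frac{(\phi(x,y')-\phi(x',y))^+}{d_Z(z',z)}\in[0,+\infty]\quad(=0\text{ if }z\text{ is isolated in }D),$$ $$\mathfrak L_\lambda[\phi](z)=\sup_{D\ni z'=(x',y')\ne z}\Big(\frac{\phi(x,y')-\phi(x',y)}{d_Z(z',z)}+\frac\lambda2d_Z(z',z)\Big)^+\in[0,+\infty]\quad(\sup\emptyset=0),$$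 and let both be $+\infty$ for $z\notin D$. Let $\mathrm{NI}(x,y)=\sup_{(x',y')\in X\times Y}(\phi(x,y')-\phi(x',y))$. **Theorem.** (A) Suppose that $\phi$ has a *continuous* coupling term. Then any two solutions $w^0,w^1$ of $\mathrm{EVIs}_\lambda$ satisfy $$d_Z^2(w^0_t,w^1_t)\le e^{-2\lambda(t-s)}d_Z^2(w^0_s,w^1_s)\qquad\text{for all }0\le s<t<+\infty$$ ($s=0$ being included if both $w^0_0$ and $w^1_0$ exist). In particular, for each $z\in\overline D$ there is at most one solution $w$ with $\lim_{t\downarrow0}w_t=z$. (B) Suppose that $\phi$ has a *locally Lipschitz* coupling term, and let $w=(u,v)$ be a solution of $\mathrm{EVIs}_\lambda$. Then: 1. For every $t>0$ the right metric derivative $|w'_t|_+=\lim_{s\downarrow t}\frac{d_Z(w_t,w_s)}{|t-s|}$ exists and is finite, and $|w_t'|_+=|\partial\phi|(w_t)=\mathfrak L_\lambda[\phi](w_t)$. 2. The maps $t\mapsto\phi(u_t,v_t)\in\mathbb R$ and $t\mapsto w_t$ are locally Lipschitz on $(0,+\infty)$. The map $t\mapsto e^{\lambda t}|\partial\phi|(w_t)$,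 with finite values on $(0,+\infty)$, is non-increasing and right continuous there; if $w_0$ exists, it is non-increasing and right continuous on $[0,+\infty)$ as a map with values in $[0,+\infty]$. 3. If $\lambda>0$, then $$\mathrm{NI}(w_t)\le\frac{e^{-2\lambda(t-s)}}{2\lambda}|\partial\phi|^2(w_s)\qquad\text{for all }0\le s<t$$ ($s=0$ being included if $w_0$ exists, the right-hand side being possibly $+\infty$). -/

import Mathlib

open Set Filter Topology
open scoped ENNReal

namespace EVIs

noncomputable section

/-- The set of `x` with `φ(x, y) < +∞` for every `y`. -/
def domX {X Y : Type*} (φ : X → Y → EReal) : Set X := {x | ∀ y, φ x y < ⊤}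

/-- The set of `y` with `φ(x, y) > -∞` for every `x`. -/
def domY {X Y : Type*} (φ : X → Y → EReal) : Set Y := {y | ∀ x, ⊥ < φ x y}

/-- The effective domain of `φ`. -/
def dom {X Y : Type*} (φ : X → Y → EReal) : Set (X × Y) := domX φ ×ˢ domY φ

/-- `φ` is proper: its effective domain is nonempty. -/
def IsProper {X Y : Type*} (φ : X → Y → EReal) : Prop := (dom φ).Nonempty

/-- `φ` is closed: semicontinuous in each variable when the other one lies in its
effective domain. -/
def IsClosedFunctional {X Y : Type*} [TopologicalSpace X] [TopologicalSpace Y]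
    (φ : X → Y → EReal) : Prop :=
  (∀ x ∈ domX φ, UpperSemicontinuous fun y => φ x y) ∧
  (∀ y ∈ domY φ, LowerSemicontinuous fun x => φ x y)

/-- The values of `φ` when exactly one of the variables is outside its effective domain. -/
def HasStandardExtension {X Y : Type*} (φ : X → Y → EReal) : Prop :=
  (∀ x ∉ domX φ, ∀ y ∈ domY φ, φ x y = ⊤) ∧
  (∀ x ∈ domX φ, ∀ y ∉ domY φ, φ x y = ⊥)

/-- On the effective domain, `φ(x, y) = c(x, y) + ψX(x) + ψY(y)` with `ψX` lower semicontinuous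
with values in `(-∞, +∞]` and `ψY` upper semicontinuous with values in `[-∞, +∞)`; the
real-valued functional `c` is the coupling term. -/
def IsCouplingTerm {X Y : Type*} [TopologicalSpace X] [TopologicalSpace Y]
    (φ : X → Y → EReal) (c : X × Y → ℝ) : Prop :=
  ∃ (ψX : X → EReal) (ψY : Y → EReal),
    (∀ x, ψX x ≠ ⊥) ∧ LowerSemicontinuous ψX ∧
    (∀ y, ψY y ≠ ⊤) ∧ UpperSemicontinuous ψY ∧
    ∀ x y, (x, y) ∈ dom φ → φ x y = (c (x, y) : EReal) + ψX x + ψY y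

/-- The `ℓ²` product distance on `X × Y`. -/
def dZ {X Y : Type*} [MetricSpace X] [MetricSpace Y] (z z' : X × Y) : ℝ :=
  Real.sqrt (dist z.1 z'.1 ^ 2 + dist z.2 z'.2 ^ 2)

/-- The (upper) right Dini derivative, with values in `[-∞, +∞]`. -/
def rightDini (f : ℝ → ℝ) (t : ℝ) : EReal :=
  limsup (fun h : ℝ => (((f (t + h) - f t) / h : ℝ) : EReal)) (𝓝[>] 0)

/-- `w = (u, v)`, restricted to `(0, +∞)`, is a solution of the system of evolution variational
inequalities driven by `φ` with parameter `lam`. The values `w t` for `t ≤ 0` play no role. -/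
structure IsSolution {X Y : Type*} [MetricSpace X] [MetricSpace Y]
    (φ : X → Y → EReal) (lam : ℝ) (w : ℝ → X × Y) : Prop where
  continuousOn : ContinuousOn w (Ioi 0)
  mem_dom : ∀ t, 0 < t → w t ∈ dom φ
  evi_fst : ∀ t, 0 < t → ∀ z ∈ dom φ,
    ((1 / 2 : ℝ) : EReal) * rightDini (fun r => dist (w r).1 z.1 ^ 2) t
        + ((lam / 2 * dist (w t).1 z.1 ^ 2 : ℝ) : EReal) + φ (w t).1 (w t).2
      ≤ φ z.1 (w t).2
  evi_snd : ∀ t, 0 < t → ∀ z ∈ dom φ,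
    ((1 / 2 : ℝ) : EReal) * rightDini (fun r => dist (w r).2 z.2 ^ 2) t
        + ((lam / 2 * dist (w t).2 z.2 ^ 2 : ℝ) : EReal) + φ (w t).1 z.2
      ≤ φ (w t).1 (w t).2

/-- The times at which a curve on `(0, +∞)` is considered: all `t > 0`, and also `t = 0` provided
that `w 0` is the limit of `w t` as `t ↓ 0`. -/
def timeDomain {X Y : Type*} [TopologicalSpace X] [TopologicalSpace Y]
    (w : ℝ → X × Y) : Set ℝ :=
  {t | 0 < t ∨ (t = 0 ∧ Tendsto w (𝓝[>] 0) (𝓝 (w 0)))}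

open Classical in
/-- The modified local slope of `φ`. In `[0, +∞]`, the upper limit is `0` at isolated points of
the effective domain. -/
def localSlope {X Y : Type*} [MetricSpace X] [MetricSpace Y]
    (φ : X → Y → EReal) (z : X × Y) : ℝ≥0∞ :=
  if z ∈ dom φ then
    limsup (fun z' : X × Y => (φ z.1 z'.2 - φ z'.1 z.2).toENNReal / ENNReal.ofReal (dZ z' z))
      (𝓝[dom φ \ {z}] z)
  else ⊤

open Classical in
/-- The global slope of `φ` with parameter `lam`; an empty supremum in `[0, +∞]` is `0`. -/
def globalSlope {X Y : Type*} [MetricSpace X] [MetricSpace Y]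
    (φ : X → Y → EReal) (lam : ℝ) (z : X × Y) : ℝ≥0∞ :=
  if z ∈ dom φ then
    ⨆ z' ∈ dom φ \ {z},
      ((φ z.1 z'.2 - φ z'.1 z.2) / ((dZ z' z : ℝ) : EReal)
        + ((lam / 2 * dZ z' z : ℝ) : EReal)).toENNReal
  else ⊤

/-- The duality gap (Nikaidô–Isoda error) of `φ`. -/
def dualityGap {X Y : Type*} (φ : X → Y → EReal) (z : X × Y) : EReal :=
  ⨆ z' : X × Y, (φ z.1 z'.2 - φ z'.1 z.2)

end

end EVIs

namespace EVIs

/-! Adding the two inequalities turns the system into one evolution variational inequality on the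
`ℓ²` product, driven by `Q(z, z') = φ(x, y') - φ(x', y)`. This gap is antisymmetric and, by
closedness, upper semicontinuous in `z'` on the domain. That is enough for contraction: when the
time variables are doubled, the inequalities of the two curves at a penalized maximum add up and
their gap terms cancel (`IsFlow.test_le`, `IsFlow.contraction`).

The rest compares slope with speed. A local slope bound controls the right speed
(`IsFlow.eventually_dist_le`), and a right speed bound, even along a sequence of times, controls the
global slope (`IsFlow.globalSlopeLE`). The global slope dominates the local one, so all three agree
where they are finite. Contraction of a flow against its own time shift makes `e^{lam t}` times the
speed, hence the slope, non-increasing (`IsFlow.globalSlopeLE_exp`).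

Finiteness at positive times uses the locally Lipschitz coupling: up to a Lipschitz error, `Q z z'`
is `A z - A z'` with `A = ψX - ψY` lower semicontinuous, and a minimum of `A` plus a linear term
along the curve is a time of finite slope (`IsFlow.exists_globalSlopeLE`). Right continuity is lower
semicontinuity of the global slope, and the duality gap bound is the maximum of `c r - lam r² / 2`
over `r`. -/

theorem continuousOn_dist {α β : Type*} [PseudoMetricSpace α] [TopologicalSpace β] {f g : β → α}
    {s : Set β} (hf : ContinuousOn f s) (hg : ContinuousOn g s) :
    ContinuousOn (fun b => dist (f b) (g b)) s :=
  fun b hb => Filter.Tendsto.dist (hf b hb) (hg b hb)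

/-! ### Right Dini derivatives and test functions. -/

/-- The upper right Dini derivative of `f` at `t` is at most `a`. -/
def RightSlopeLE (f : ℝ → ℝ) (t a : ℝ) : Prop :=
  ∀ r, a < r → ∀ᶠ s in 𝓝[>] t, slope f t s < r

theorem RightSlopeLE.add {f g : ℝ → ℝ} {t a b : ℝ} (hf : RightSlopeLE f t a)
    (hg : RightSlopeLE g t b) : RightSlopeLE (fun s => f s + g s) t (a + b) := by
  intro r hr
  filter_upwards [hf (a + (r - a - b) / 2) (by linarith), hg (b + (r - a - b) / 2) (by linarith)]
    with s h1 h2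
  have : slope (fun s => f s + g s) t s = slope f t s + slope g t s := by
    simp only [slope_def_field]; ring
  rw [this]; linarith

/-- A function whose right Dini derivative is controlled by an upper semicontinuous `g` is a
viscosity subsolution of `f' ≤ g` with respect to test functions touching from the left. -/
theorem RightSlopeLE.deriv_le_of_touching {f g p : ℝ → ℝ} {a s p' : ℝ} (has : a < s)
    (hf : ContinuousOn f (Icc a s)) (hfg : ∀ r ∈ Ico a s, RightSlopeLE f r (g r))
    (hg : ∀ m, g s < m → ∀ᶠ r in 𝓝[<] s, g r < m) (hle : ∀ r ∈ Icc a s, f r ≤ p r)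
    (heq : f s = p s) (hp : HasDerivAt p p' s) : p' ≤ g s := by
  by_contra! hlt
  obtain ⟨m, hm1, hm2⟩ := exists_between hlt
  obtain ⟨l, hl, hlg⟩ := (mem_nhdsLT_iff_exists_Ioo_subset).1 (hg m hm1)
  have hev : ∀ᶠ r in 𝓝[<] s, slope p s r ≤ m := by
    filter_upwards [Ioo_mem_nhdsLT (max_lt hl has)] with r hr
    have hlr : l < r := (le_max_left _ _).trans_lt hr.1
    have har : a < r := (le_max_right _ _).trans_lt hr.1
    -- Near `s` the bound `g < m` integrates to growth at rate at most `m` up to `s`. As `p` lies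
    -- above `f` and meets it at `s`, the left slopes of `p` are at most `m`.
    have key : f s ≤ f r + m * (s - r) := by
      refine image_le_of_liminf_slope_right_le_deriv_boundary (f := f) (a := r) (b := s)
        (B := fun x => f r + m * (x - r)) (B' := fun _ => m)
        (hf.mono (Icc_subset_Icc har.le le_rfl)) (by simp) (by fun_prop) ?_ ?_
        (right_mem_Icc.2 hr.2.le)
      · intro x _
        simpa using ((((hasDerivAt_id x).sub_const r).const_mul m).const_add (f r)).hasDerivWithinAt
      · intro x hx q hq
        exact (hfg x ⟨har.le.trans hx.1, hx.2⟩ q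
          ((hlg ⟨hlr.trans_le hx.1, hx.2⟩ : g x < m).trans hq)).frequently
    have h1 := hle r ⟨har.le, hr.2.le⟩
    rw [slope_comm, slope_def_field, div_le_iff₀ (sub_pos.2 hr.2)]
    linarith
  have := le_of_tendsto (hasDerivAt_iff_tendsto_slope_left_right.1 hp).1 hev
  linarith

/-! ### Antisymmetric gaps and contraction of their flows. -/

section Abstract

variable {M : Type*} [MetricSpace M]

/-- An antisymmetric functional on `D` which is upper semicontinuous in the second variable. -/
structure IsGap (D : Set M) (Q : M → M → ℝ) : Prop where
  antisymm : ∀ z ∈ D, ∀ z' ∈ D, Q z z' = -Q z' z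
  usc : ∀ z ∈ D, UpperSemicontinuousOn (Q z) D

/-- Solutions of the evolution variational inequality
`½ d⁺/dt d²(W, z) + lam/2 d²(W, z) ≤ Q(z, W)` for every `z ∈ D`. -/
structure IsFlow (D : Set M) (Q : M → M → ℝ) (lam : ℝ) (W : ℝ → M) : Prop where
  continuousOn : ContinuousOn W (Ioi 0)
  mem : ∀ t, 0 < t → W t ∈ D
  evi : ∀ t, 0 < t → ∀ z ∈ D,
    RightSlopeLE (fun r => dist (W r) z ^ 2) t (2 * Q z (W t) - lam * dist (W t) z ^ 2)

variable {D : Set M} {Q : M → M → ℝ} {lam : ℝ} {W W₀ W₁ : ℝ → M}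

theorem IsFlow.tendsto_within (h : IsFlow D Q lam W) {t : ℝ} (ht : 0 < t) :
    Tendsto W (𝓝 t) (𝓝[D] (W t)) :=
  tendsto_nhdsWithin_iff.2 ⟨h.continuousOn.continuousAt (Ioi_mem_nhds ht),
    Filter.mem_of_superset (Ioi_mem_nhds ht) fun _ hs => h.mem _ hs⟩

/-- Solving the maximality condition for `dist (W r) z ^ 2` gives a smooth function touching it from
above at `s`, to be inserted in the variational inequality. Only times `r ≤ s` are compared, so `s`
may be the right end of the interval of maximization. The exponential factor absorbs the `lam` term.
-/
theorem IsFlow.test_le (hQ : IsGap D Q) (h : IsFlow D Q lam W) {a s τ η N : ℝ} (ha : 0 < a)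
    (has : a < s) {z : M} (hz : z ∈ D)
    (hmax : ∀ r ∈ Icc a s,
      Real.exp (lam * (r + τ)) * dist (W r) z ^ 2 - η * (r + τ) - N * (r - τ) ^ 2
        ≤ Real.exp (lam * (s + τ)) * dist (W s) z ^ 2 - η * (s + τ) - N * (s - τ) ^ 2) :
    Real.exp (-(lam * (s + τ))) * (η + 2 * N * (s - τ)) ≤ 2 * Q z (W s) := by
  set m := Real.exp (lam * (s + τ)) * dist (W s) z ^ 2 - η * (s + τ) - N * (s - τ) ^ 2 with hm
  have hEE : ∀ r, Real.exp (-(lam * (r + τ))) * Real.exp (lam * (r + τ)) = 1 := fun r => by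
    rw [← Real.exp_add]; simp
  have hs : 0 < s := ha.trans has
  have hsol : dist (W s) z ^ 2
      = Real.exp (-(lam * (s + τ))) * (m + η * (s + τ) + N * (s - τ) ^ 2) := by
    linear_combination (-dist (W s) z ^ 2) * hEE s - Real.exp (-(lam * (s + τ))) * hm
  have hd : HasDerivAt (fun r => Real.exp (-(lam * (r + τ))) * (m + η * (r + τ) + N * (r - τ) ^ 2))
      (-lam * dist (W s) z ^ 2 + Real.exp (-(lam * (s + τ))) * (η + 2 * N * (s - τ))) s := by
    have h1 : HasDerivAt (fun r => Real.exp (-(lam * (r + τ))))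
        (Real.exp (-(lam * (s + τ))) * (-(lam * 1))) s :=
      ((((hasDerivAt_id s).add_const τ).const_mul lam).neg).exp
    have h2 : HasDerivAt (fun r => m + η * (r + τ) + N * (r - τ) ^ 2)
        (η * 1 + N * (((2 : ℕ) : ℝ) * (s - τ) ^ (2 - 1) * 1)) s :=
      ((((hasDerivAt_id s).add_const τ).const_mul η).const_add m).add
        ((((hasDerivAt_id s).sub_const τ).pow 2).const_mul N)
    refine (h1.mul h2).congr_deriv ?_
    rw [hsol]; push_cast; ring
  have := RightSlopeLE.deriv_le_of_touching (f := fun r => dist (W r) z ^ 2)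
    (g := fun r => 2 * Q z (W r) - lam * dist (W r) z ^ 2) has
    ((continuousOn_dist (h.continuousOn.mono fun r (hr : r ∈ Icc a s) => ha.trans_le hr.1)
      continuousOn_const).pow 2)
    (fun r hr => h.evi r (ha.trans_le hr.1) z hz) ?_ ?_ hsol hd
  · linarith
  · intro q hq
    have hT := h.tendsto_within hs
    have hdist : Tendsto (fun r => lam * dist (W r) z ^ 2) (𝓝 s) (𝓝 (lam * dist (W s) z ^ 2)) :=
      (((tendsto_nhds_of_tendsto_nhdsWithin hT).dist tendsto_const_nhds).pow 2).const_mul lam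
    set e := q - (2 * Q z (W s) - lam * dist (W s) z ^ 2) with he
    have hu := hT.eventually (hQ.usc z hz (W s) (h.mem s hs) (Q z (W s) + e / 4) (by linarith))
    refine nhdsWithin_le_nhds ?_
    filter_upwards [hu, hdist.eventually (lt_mem_nhds (show lam * dist (W s) z ^ 2 - e / 4 < _ by
      linarith))] with r h1 h2
    linarith
  · intro r hr
    have h1 := mul_le_mul_of_nonneg_left (hmax r hr) (Real.exp_pos (-(lam * (r + τ)))).le
    have h2 := hEE r
    linear_combination h1 - dist (W r) z ^ 2 * h2

/-- Doubling of variables: `e^{2 lam t} d²(W₀ t, W₁ t)` is non-increasing. -/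
theorem IsFlow.contraction (hQ : IsGap D Q) (h₀ : IsFlow D Q lam W₀) (h₁ : IsFlow D Q lam W₁)
    {a b : ℝ} (ha : 0 < a) (hab : a < b) :
    Real.exp (lam * (b + b)) * dist (W₀ b) (W₁ b) ^ 2
      ≤ Real.exp (lam * (a + a)) * dist (W₀ a) (W₁ a) ^ 2 := by
  by_contra! hlt
  set F : ℝ × ℝ → ℝ := fun p => Real.exp (lam * (p.1 + p.2)) * dist (W₀ p.1) (W₁ p.2) ^ 2 with hF
  -- This `η` spends half of the assumed increase of `F` from `(a, a)` to `(b, b)`.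
  obtain ⟨η, hη, hηF⟩ : ∃ η > 0, F (a, a) - η * (a + a) < F (b, b) - η * (b + b) := by
    refine ⟨(F (b, b) - F (a, a)) / (4 * (b - a)), ?_, ?_⟩
    · have : 0 < F (b, b) - F (a, a) := sub_pos.2 hlt
      have := sub_pos.2 hab
      positivity
    · have h1 : (F (b, b) - F (a, a)) / (4 * (b - a)) * (4 * (b - a)) = F (b, b) - F (a, a) := by
        have := sub_pos.2 hab
        field_simp
      have : 0 < F (b, b) - F (a, a) := sub_pos.2 hlt
      linarith
  set K : Set (ℝ × ℝ) := Icc a b ×ˢ Icc a b with hK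
  have hKc : IsCompact K := isCompact_Icc.prod isCompact_Icc
  set ψ : ℝ × ℝ → ℝ := fun p => F p - η * (p.1 + p.2) with hψ
  have hψc : ContinuousOn ψ K := by
    have e0 : ContinuousOn (fun p : ℝ × ℝ => W₀ p.1) K :=
      h₀.continuousOn.comp continuousOn_fst fun p hp => ha.trans_le hp.1.1
    have e1 : ContinuousOn (fun p : ℝ × ℝ => W₁ p.2) K :=
      h₁.continuousOn.comp continuousOn_snd fun p hp => ha.trans_le hp.2.1
    exact ((Continuous.continuousOn (by fun_prop)).mul ((continuousOn_dist e0 e1).pow 2)).sub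
      (Continuous.continuousOn (by fun_prop))
  have haK : (a, a) ∈ K := ⟨left_mem_Icc.2 hab.le, left_mem_Icc.2 hab.le⟩
  have hbK : (b, b) ∈ K := ⟨right_mem_Icc.2 hab.le, right_mem_Icc.2 hab.le⟩
  obtain ⟨C, hC⟩ := hKc.bddAbove_image hψc
  obtain ⟨δ, hδ, hball⟩ := Metric.mem_nhdsWithin_iff.1
    ((hψc (a, a) haK).eventually (gt_mem_nhds (show ψ (a, a) < ψ (b, b) from hηF)))
  -- The penalty is large enough to force any maximizer within `δ` of the diagonal. A maximizer with
  -- `s = a` or `t = a` would then lie in the ball around `(a, a)` where `ψ < ψ (b, b)`.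
  obtain ⟨N, hN⟩ := exists_nat_gt ((C - ψ (b, b)) / δ ^ 2)
  rw [div_lt_iff₀ (by positivity)] at hN
  obtain ⟨⟨s, t⟩, hst, hmaxOn⟩ := hKc.exists_isMaxOn ⟨_, hbK⟩
    (hψc.sub (Continuous.continuousOn (by fun_prop : Continuous fun p : ℝ × ℝ =>
      (N : ℝ) * (p.1 - p.2) ^ 2)))
  have hmax : ∀ p ∈ K, ψ p - N * (p.1 - p.2) ^ 2 ≤ ψ (s, t) - N * (s - t) ^ 2 :=
    fun p hp => hmaxOn hp
  have hb : ψ (b, b) ≤ ψ (s, t) - N * (s - t) ^ 2 := by simpa using hmax _ hbK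
  have hdiag : |s - t| < δ := by
    have h1 : ψ (s, t) ≤ C := hC (mem_image_of_mem _ hst)
    by_contra! h2
    have h3 : δ ^ 2 ≤ (s - t) ^ 2 := by rw [← sq_abs (s - t)]; gcongr
    have h4 := mul_le_mul_of_nonneg_left h3 (Nat.cast_nonneg (α := ℝ) N)
    linarith
  have hclose : ¬ (|s - a| < δ ∧ |t - a| < δ) := by
    rintro ⟨h1, h2⟩
    have h3 : ψ (s, t) < ψ (b, b) := by
      refine hball ⟨?_, hst⟩
      rw [Metric.mem_ball, Prod.dist_eq]
      exact max_lt (by simpa [Real.dist_eq] using h1) (by simpa [Real.dist_eq] using h2)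
    have : 0 ≤ (N : ℝ) * (s - t) ^ 2 := by positivity
    linarith
  have has : a < s := lt_of_le_of_ne hst.1.1 fun hsa => hclose (by
    subst hsa; rw [abs_sub_comm] at hdiag; simpa [hδ] using hdiag)
  have hat : a < t := lt_of_le_of_ne hst.2.1 fun hta => hclose (by
    subst hta; simpa [hδ] using hdiag)
  have hs : W₀ s ∈ D := h₀.mem s (ha.trans has)
  have ht : W₁ t ∈ D := h₁.mem t (ha.trans hat)
  -- Each time variable is tested with the other frozen. In the sum the penalty derivatives `2N(s -
  -- t)` and `2N(t - s)` cancel, as do the two gaps by antisymmetry, leaving a positive multiple of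
  -- `η` bounded by zero.
  have k0 := h₀.test_le hQ (τ := t) (η := η) (N := N) ha has ht (fun r hr => by
    exact hmax (r, t) ⟨⟨hr.1, hr.2.trans hst.1.2⟩, hst.2⟩)
  have k1 := h₁.test_le hQ (τ := s) (η := η) (N := N) ha hat hs (fun r hr => by
    have := hmax (s, r) ⟨hst.1, ⟨hr.1, hr.2.trans hst.2.2⟩⟩
    simp only [hψ, hF] at this
    rw [dist_comm (W₁ r), dist_comm (W₁ t), add_comm r, add_comm t]
    linarith [this, sub_sq_comm s r, sub_sq_comm s t])
  rw [hQ.antisymm _ ht _ hs] at k0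
  rw [add_comm t s] at k1
  have : 0 < Real.exp (-(lam * (s + t))) * η := by positivity
  linarith

theorem IsFlow.shift (h : IsFlow D Q lam W) {k : ℝ} (hk : 0 ≤ k) :
    IsFlow D Q lam (fun t => W (t + k)) where
  continuousOn := h.continuousOn.comp (by fun_prop) fun t ht => by
    simp only [mem_Ioi] at *; linarith
  mem t ht := h.mem _ (by linarith)
  evi t ht z hz := by
    intro r hr
    have hT : Tendsto (fun s => s + k) (𝓝[>] t) (𝓝[>] (t + k)) := by
      refine tendsto_nhdsWithin_iff.2 ⟨?_, ?_⟩
      · exact (Continuous.tendsto (by fun_prop) t).mono_left nhdsWithin_le_nhds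
      · filter_upwards [self_mem_nhdsWithin] with s hs
        simpa using hs
    filter_upwards [hT.eventually (h.evi (t + k) (by linarith) z hz r hr)] with s hs
    simpa [slope_def_field] using hs

/-- The contraction passes to the limit from interior times, which brings in `s = 0`, where no
variational inequality is available. -/
theorem IsFlow.contraction_of_tendsto (hQ : IsGap D Q) (h₀ : IsFlow D Q lam W₀)
    (h₁ : IsFlow D Q lam W₁) {s t : ℝ} {z₀ z₁ : M} (hs : 0 ≤ s) (hst : s < t)
    (hz₀ : Tendsto W₀ (𝓝[>] s) (𝓝 z₀)) (hz₁ : Tendsto W₁ (𝓝[>] s) (𝓝 z₁)) :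
    dist (W₀ t) (W₁ t) ^ 2 ≤ Real.exp (-2 * lam * (t - s)) * dist z₀ z₁ ^ 2 := by
  have hlim : Real.exp (lam * (t + t)) * dist (W₀ t) (W₁ t) ^ 2
      ≤ Real.exp (lam * (s + s)) * dist z₀ z₁ ^ 2 := by
    refine ge_of_tendsto (x := 𝓝[>] s)
      (f := fun a => Real.exp (lam * (a + a)) * dist (W₀ a) (W₁ a) ^ 2)
      (Tendsto.mul ?_ ((hz₀.dist hz₁).pow 2)) ?_
    · exact (Continuous.tendsto (by fun_prop) s).mono_left nhdsWithin_le_nhds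
    · filter_upwards [Ioo_mem_nhdsGT hst] with a hat
      exact h₀.contraction hQ h₁ (hs.trans_lt hat.1) hat.2
  have hE : Real.exp (-2 * lam * (t - s)) = Real.exp (lam * (s + s)) / Real.exp (lam * (t + t)) := by
    rw [← Real.exp_sub]; ring_nf
  rw [hE, div_mul_eq_mul_div, le_div_iff₀ (Real.exp_pos _)]
  linarith

/-- Contraction between a solution and its time shift, from any time `s ≥ 0` of right
continuity. -/
theorem IsFlow.dist_shift_le (hQ : IsGap D Q) (h : IsFlow D Q lam W) {s t k : ℝ} (hs : 0 ≤ s)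
    (hcs : ContinuousWithinAt W (Ioi s) s) (hst : s < t) (hk : 0 < k) :
    Real.exp (lam * (t - s)) * dist (W (t + k)) (W t) ≤ dist (W (s + k)) (W s) := by
  have hk' : Tendsto (fun a => W (a + k)) (𝓝[>] s) (𝓝 (W (s + k))) := by
    have : ContinuousAt W (s + k) := h.continuousOn.continuousAt (Ioi_mem_nhds (by linarith))
    refine Tendsto.comp (f := fun a => a + k) this ?_
    exact (Continuous.tendsto (by fun_prop) s).mono_left nhdsWithin_le_nhds
  have key := (h.shift hk.le).contraction_of_tendsto hQ h hs hst hk' hcs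
  have hE : Real.exp (lam * (t - s)) ^ 2 * Real.exp (-2 * lam * (t - s)) = 1 := by
    rw [← Real.exp_nat_mul, ← Real.exp_add]
    simp; ring
  refine le_of_sq_le_sq ?_ dist_nonneg
  have := mul_le_mul_of_nonneg_left key (sq_nonneg (Real.exp (lam * (t - s))))
  linear_combination this + dist (W (s + k)) (W s) ^ 2 * hE

/-! ### Slope bounds and speed. -/

/-- `c` bounds the global slope at `z`. -/
def GlobalSlopeLE (D : Set M) (Q : M → M → ℝ) (lam c : ℝ) (z : M) : Prop :=
  ∀ z' ∈ D, Q z z' ≤ c * dist z z' - lam / 2 * dist z z' ^ 2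

/-- `c` bounds the local slope at `z`. -/
def LocalSlopeLE (D : Set M) (Q : M → M → ℝ) (c : ℝ) (z : M) : Prop :=
  ∀ c', c < c' → ∀ᶠ z' in 𝓝[D] z, Q z z' ≤ c' * dist z z'

theorem eventually_quadratic_le (z : M) (a : ℝ) {ε : ℝ} (hε : 0 < ε) :
    ∀ᶠ z' in 𝓝 z, -a * dist z z' ^ 2 ≤ ε * dist z z' := by
  have : Tendsto (fun z' => |a| * dist z z') (𝓝 z) (𝓝 (|a| * dist z z)) :=
    (tendsto_const_nhds.dist tendsto_id).const_mul _
  rw [dist_self, mul_zero] at this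
  filter_upwards [this.eventually (gt_mem_nhds hε)] with z' hz'
  have h1 : -a ≤ |a| := neg_le_abs a
  have h2 : 0 ≤ dist z z' := dist_nonneg
  calc -a * dist z z' ^ 2 ≤ |a| * dist z z' ^ 2 := by gcongr
    _ = (|a| * dist z z') * dist z z' := by ring
    _ ≤ _ := by gcongr

theorem GlobalSlopeLE.localSlopeLE {c : ℝ} {z : M} (h : GlobalSlopeLE D Q lam c z) :
    LocalSlopeLE D Q c z := by
  intro c' hc'
  filter_upwards [self_mem_nhdsWithin,
    nhdsWithin_le_nhds (eventually_quadratic_le z (lam / 2) (sub_pos.2 hc'))] with z' hz' h'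
  linarith [h z' hz']

theorem GlobalSlopeLE.of_forall_lt {c : ℝ} {z : M}
    (h : ∀ c', c < c' → GlobalSlopeLE D Q lam c' z) : GlobalSlopeLE D Q lam c z := by
  intro z' hz'
  have hT : Tendsto (fun c' => c' * dist z z' - lam / 2 * dist z z' ^ 2) (𝓝[>] c)
      (𝓝 (c * dist z z' - lam / 2 * dist z z' ^ 2)) :=
    (Continuous.tendsto (by fun_prop) c).mono_left nhdsWithin_le_nhds
  refine ge_of_tendsto hT ?_
  filter_upwards [self_mem_nhdsWithin] with c' hc'
  exact h c' hc' z' hz'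

/-- Comparison principle for the distance from the initial point. -/
theorem IsFlow.dist_le_of_growth (h : IsFlow D Q lam W) {s b : ℝ} (hs : 0 ≤ s)
    (hcs : ContinuousWithinAt W (Ioi s) s) (hsD : W s ∈ D) {κ K c : ℝ} (hK : 0 ≤ K)
    (hc : 0 < c) (hκ : κ * c + K < c ^ 2)
    (hg : ∀ r ∈ Ioo s b, 2 * Q (W s) (W r) - lam * dist (W r) (W s) ^ 2
      ≤ 2 * (κ * dist (W r) (W s) + K * (r - s))) :
    ∀ r ∈ Ioo s b, dist (W r) (W s) ≤ c * (r - s) := by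
  intro r hr
  refine le_of_forall_pos_le_add fun ε hε => ?_
  -- The comparison starts at `q > s`, since `s` may be `0`. The margin `ε` absorbs the initial
  -- distance and makes the inequality at a contact point strict.
  obtain ⟨q, hqε, hq⟩ := (((Metric.tendsto_nhds.1 hcs ε hε)).and (Ioo_mem_nhdsGT hr.1)).exists
  have hpos : ∀ x ∈ Icc q r, 0 < x - s := fun x hx => by linarith [hx.1, hq.1]
  have hκc : κ < c := lt_of_mul_lt_mul_right (by linarith : κ * c < c * c) hc.le
  have := image_le_of_liminf_slope_right_lt_deriv_boundary (f := fun x => dist (W x) (W s) ^ 2)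
    (f' := fun x => 2 * Q (W s) (W x) - lam * dist (W x) (W s) ^ 2) (a := q) (b := r)
    (B := fun x => (c * (x - s) + ε) ^ 2) (B' := fun x => 2 * (c * (x - s) + ε) * c)
    ((continuousOn_dist (h.continuousOn.mono fun x hx => (hs.trans_lt (sub_pos.1 (hpos x hx))))
      continuousOn_const).pow 2)
    (fun x hx m hm => (h.evi x (hs.trans_lt (sub_pos.1 (hpos x ⟨hx.1, hx.2.le⟩))) _ hsD m
      hm).frequently)
    ?_ ?_ ?_ (right_mem_Icc.2 hq.2.le)
  · refine le_of_sq_le_sq this ?_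
    have := hpos r (right_mem_Icc.2 hq.2.le)
    positivity
  · have := hpos q (left_mem_Icc.2 hq.2.le)
    have : 0 ≤ c * (q - s) := by positivity
    gcongr
    linarith
  · intro x
    refine (((((hasDerivAt_id x).sub_const s).const_mul c).add_const ε).pow 2).congr_deriv ?_
    simp
  · intro x hx heq
    have hx0 := hpos x ⟨hx.1, hx.2.le⟩
    have hB : 0 < c * (x - s) + ε := by positivity
    have hd : dist (W x) (W s) = c * (x - s) + ε :=
      (pow_left_inj₀ dist_nonneg hB.le two_ne_zero).1 heq
    have h1 := hg x ⟨hq.1.trans_le hx.1, hx.2.trans hr.2⟩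
    have h2 : κ * dist (W x) (W s) + K * (x - s) < (c * (x - s) + ε) * c := by
      rw [hd]
      have := mul_lt_mul_of_pos_right hκ hx0
      have := mul_lt_mul_of_pos_right hκc hε
      linarith
    linarith

/-- The inequality is tested at the starting point `W s` itself: its right side is then at most
about `2 c * dist`, so the distance grows at rate at most about `c`. -/
theorem IsFlow.eventually_dist_le (h : IsFlow D Q lam W) {s c c' : ℝ} (hs : 0 ≤ s)
    (hcs : ContinuousWithinAt W (Ioi s) s) (hsD : W s ∈ D) (hc : 0 ≤ c)
    (hsl : LocalSlopeLE D Q c (W s)) (hcc : c < c') :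
    ∀ᶠ r in 𝓝[>] s, dist (W r) (W s) ≤ c' * (r - s) := by
  have hT : Tendsto W (𝓝[>] s) (𝓝[D] (W s)) := tendsto_nhdsWithin_iff.2 ⟨hcs, by
    filter_upwards [self_mem_nhdsWithin] with r hr
    exact h.mem r (hs.trans_lt hr)⟩
  -- One third of `c' - c` pays for the local slope, another for the quadratic term; the last keeps
  -- the comparison strict.
  have hev : ∀ᶠ r in 𝓝[>] s, 2 * Q (W s) (W r) - lam * dist (W r) (W s) ^ 2
      ≤ 2 * ((c + 2 * ((c' - c) / 3)) * dist (W r) (W s) + 0 * (r - s)) := by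
    filter_upwards [hT.eventually (hsl (c + (c' - c) / 3) (by linarith)),
      hT.eventually (nhdsWithin_le_nhds (eventually_quadratic_le (W s) (lam / 2)
        (show 0 < (c' - c) / 3 by linarith)))] with r h1 h2
    rw [dist_comm (W r)]
    linarith
  obtain ⟨b, hb, hbs⟩ := mem_nhdsGT_iff_exists_Ioo_subset.1 hev
  filter_upwards [Ioo_mem_nhdsGT hb]
  refine h.dist_le_of_growth hs hcs hsD le_rfl (hc.trans_lt hcc) ?_ fun r hr => hbs hr
  have : 0 < c' := hc.trans_lt hcc
  nlinarith

/-- By the reverse triangle inequality, a point moving at speed `c` cannot decrease its squared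
distance to `z` faster than `2 c * dist (W t) z`. The variational inequality turns this into a bound
on `Q (W t) z` for every `z`, and one sequence of times suffices. -/
theorem IsFlow.globalSlopeLE (hQ : IsGap D Q) (h : IsFlow D Q lam W) {t c : ℝ} (ht : 0 < t)
    (hfr : ∃ᶠ r in 𝓝[>] t, dist (W r) (W t) ≤ c * (r - t)) :
    GlobalSlopeLE D Q lam c (W t) := by
  intro z hz
  by_contra! hlt
  rw [hQ.antisymm _ (h.mem t ht) _ hz] at hlt
  obtain ⟨r, h1, h2, h3⟩ := (hfr.and_eventually ((h.evi t ht z hz (-(2 * c * dist (W t) z))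
    (by linarith)).and self_mem_nhdsWithin)).exists
  rw [slope_def_field, div_lt_iff₀ (sub_pos.2 h3)] at h2
  have h4 : (dist (W t) z - dist (W r) (W t)) ^ 2 ≤ dist (W r) z ^ 2 := by
    rw [sq_le_sq, abs_of_nonneg (dist_nonneg : 0 ≤ dist (W r) z), abs_le]
    constructor
    · linarith [dist_triangle (W r) (W t) z, dist_triangle (W t) (W r) z, dist_comm (W t) (W r),
        dist_triangle (W r) z (W t), dist_comm z (W t)]
    · linarith [dist_triangle (W t) (W r) z, dist_comm (W t) (W r)]
  have h5 := mul_le_mul_of_nonneg_left h1 (dist_nonneg : 0 ≤ dist (W t) z)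
  nlinarith [sq_nonneg (dist (W r) (W t))]

/-- Local slope at `s` bounds the speed there, contraction against the time shift carries the speed
to `t`, and speed at `t` bounds the global slope. -/
theorem IsFlow.globalSlopeLE_exp (hQ : IsGap D Q) (h : IsFlow D Q lam W) {s t c : ℝ} (hs : 0 ≤ s)
    (hcs : ContinuousWithinAt W (Ioi s) s) (hsD : W s ∈ D) (hc : 0 ≤ c)
    (hsl : LocalSlopeLE D Q c (W s)) (hst : s < t) :
    GlobalSlopeLE D Q lam (Real.exp (-lam * (t - s)) * c) (W t) := by
  have hE : Real.exp (-lam * (t - s)) * Real.exp (lam * (t - s)) = 1 := by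
    rw [← Real.exp_add]; simp
  refine .of_forall_lt fun m hm => h.globalSlopeLE hQ (hs.trans_lt hst) (Eventually.frequently ?_)
  have hm' : c < Real.exp (lam * (t - s)) * m := by
    have := mul_lt_mul_of_pos_left hm (Real.exp_pos (lam * (t - s)))
    linear_combination this - c * hE
  have hT : Tendsto (fun r => r - t + s) (𝓝[>] t) (𝓝[>] s) := by
    refine tendsto_nhdsWithin_iff.2 ⟨?_, ?_⟩
    · have : Tendsto (fun r => r - t + s) (𝓝 t) (𝓝 (t - t + s)) :=
        Continuous.tendsto (by fun_prop) t
      rw [sub_self, zero_add] at this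
      exact this.mono_left nhdsWithin_le_nhds
    · filter_upwards [self_mem_nhdsWithin] with r hr
      simpa using hr
  filter_upwards [self_mem_nhdsWithin, hT.eventually (h.eventually_dist_le hs hcs hsD hc hsl hm')]
    with r hr h1
  have h2 := h.dist_shift_le hQ hs hcs hst (sub_pos.2 hr)
  rw [show t + (r - t) = r by ring, show s + (r - t) = r - t + s by ring] at h2
  have h3 := mul_le_mul_of_nonneg_left (h2.trans h1) (Real.exp_pos (-lam * (t - s))).le
  linear_combination h3 + (m * (r - t) - dist (W r) (W t)) * hE

/-- By antisymmetry, `Q` is lower semicontinuous in its first variable, so each inequality defining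
the bound survives the limit. -/
theorem GlobalSlopeLE.of_tendsto (hQ : IsGap D Q) {ι : Type*} {l : Filter ι} [l.NeBot] {ζ : ι → M}
    {γ : ι → ℝ} {z : M} {c : ℝ} (hz : z ∈ D) (hζ : Tendsto ζ l (𝓝[D] z)) (hγ : Tendsto γ l (𝓝 c))
    (h : ∀ᶠ i in l, GlobalSlopeLE D Q lam (γ i) (ζ i)) : GlobalSlopeLE D Q lam c z := by
  intro z' hz'
  by_contra! hlt
  rw [hQ.antisymm _ hz _ hz'] at hlt
  obtain ⟨m, hm1, hm2⟩ := exists_between hlt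
  have hd : Tendsto (fun i => γ i * dist (ζ i) z' - lam / 2 * dist (ζ i) z' ^ 2) l
      (𝓝 (c * dist z z' - lam / 2 * dist z z' ^ 2)) := by
    have := (tendsto_nhds_of_tendsto_nhdsWithin hζ).dist (tendsto_const_nhds (x := z'))
    exact (hγ.mul this).sub ((this.pow 2).const_mul _)
  obtain ⟨i, h1, h2, h3, h4⟩ := (h.and ((hζ.eventually self_mem_nhdsWithin).and
    ((hd.eventually (gt_mem_nhds hm1)).and
      (hζ.eventually (hQ.usc z' hz' z hz (-m) (by linarith)))))).exists
  have := h1 z' hz'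
  rw [hQ.antisymm _ h2 _ hz'] at this
  linarith

/-! ### Finite slope and Lipschitz regularity at positive times. -/

/-- Up to a locally Lipschitz error, `Q` is the increment of a lower semicontinuous function. -/
def HasPotential (D : Set M) (Q : M → M → ℝ) : Prop :=
  ∃ A : M → ℝ, LowerSemicontinuousOn A D ∧
    ∀ z ∈ D, ∃ L, 0 ≤ L ∧ ∀ᶠ z' in 𝓝[D] z, Q z z' ≤ L * dist z z' + A z - A z'

theorem IsFlow.exists_globalSlopeLE (hQ : IsGap D Q) (hP : HasPotential D Q)
    (h : IsFlow D Q lam W) {t : ℝ} (ht : 0 < t) : ∃ c, 0 ≤ c ∧ GlobalSlopeLE D Q lam c (W t) := by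
  obtain ⟨A, hA, hAQ⟩ := hP
  set a := t / 2 with ha
  have ha0 : 0 < a := by positivity
  have hat : a < t := by linarith
  -- With this `K` the endpoint `t` is not a minimizer of `A (W r) + K * r`. To the right of a
  -- minimizer `s < t`, `A (W s) - A (W r) ≤ K * (r - s)`, which is the growth condition needed for
  -- a speed bound at `s`.
  obtain ⟨K, hK0, hK⟩ : ∃ K, 0 ≤ K ∧ A (W a) + K * a < A (W t) + K * t := by
    refine ⟨(|A (W a) - A (W t)| + 1) / (t - a), ?_, ?_⟩
    · have := sub_pos.2 hat
      positivity
    · have h1 : (|A (W a) - A (W t)| + 1) / (t - a) * (t - a) = |A (W a) - A (W t)| + 1 :=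
        div_mul_cancel₀ _ (sub_pos.2 hat).ne'
      have := le_abs_self (A (W a) - A (W t))
      linarith
  have hlsc : LowerSemicontinuousOn (fun r => A (W r) + K * r) (Icc a t) := by
    have h1 : LowerSemicontinuousOn (fun r => A (W r)) (Icc a t) := by
      intro r hr y hy
      have hr0 : 0 < r := ha0.trans_le hr.1
      exact nhdsWithin_le_nhds ((h.tendsto_within hr0).eventually (hA _ (h.mem r hr0) y hy))
    exact h1.add (Continuous.continuousOn (by fun_prop)).lowerSemicontinuousOn
  obtain ⟨s, hs, hmin⟩ := hlsc.exists_isMinOn ⟨a, left_mem_Icc.2 hat.le⟩ isCompact_Icc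
  have hs0 : 0 < s := ha0.trans_le hs.1
  have hst : s < t := lt_of_le_of_ne hs.2 fun hst => by
    have := hmin (left_mem_Icc.2 hat.le)
    simp only [mem_ofPred_eq, hst] at this
    linarith
  have hcs : ContinuousWithinAt W (Ioi s) s :=
    (h.continuousOn.continuousAt (Ioi_mem_nhds hs0)).continuousWithinAt
  obtain ⟨L, hL, hLQ⟩ := hAQ _ (h.mem s hs0)
  have hev : ∀ᶠ r in 𝓝[>] s, 2 * Q (W s) (W r) - lam * dist (W r) (W s) ^ 2
      ≤ 2 * ((L + 1) * dist (W r) (W s) + K * (r - s)) := by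
    filter_upwards [nhdsWithin_le_nhds ((h.tendsto_within hs0).eventually hLQ),
      nhdsWithin_le_nhds ((h.tendsto_within hs0).eventually (nhdsWithin_le_nhds
        (eventually_quadratic_le (W s) (lam / 2) one_pos))), Ioo_mem_nhdsGT hst] with r h1 h2 h3
    have h4 : A (W s) + K * s ≤ A (W r) + K * r := hmin ⟨hs.1.trans h3.1.le, h3.2.le⟩
    rw [dist_comm (W r)]
    linarith
  obtain ⟨b, hb, hbs⟩ := mem_nhdsGT_iff_exists_Ioo_subset.1 hev
  have hg := h.dist_le_of_growth hs0.le hcs (h.mem s hs0) (c := L + K + 2) hK0 (by positivity)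
    (by nlinarith) fun r hr => hbs hr
  have hG : GlobalSlopeLE D Q lam (L + K + 2) (W s) := h.globalSlopeLE hQ hs0
    (Eventually.frequently (by filter_upwards [Ioo_mem_nhdsGT hb] using hg))
  exact ⟨_, by positivity, h.globalSlopeLE_exp hQ hs0.le hcs (h.mem s hs0) (by positivity)
    hG.localSlopeLE hst⟩

theorem GlobalSlopeLE.mono {c c' : ℝ} {z : M} (h : GlobalSlopeLE D Q lam c z) (hc : c ≤ c') :
    GlobalSlopeLE D Q lam c' z := fun z' hz' =>
  (h z' hz').trans (by gcongr)

theorem IsFlow.exists_globalSlopeLE_Icc (hQ : IsGap D Q) (hP : HasPotential D Q)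
    (h : IsFlow D Q lam W) {a b : ℝ} (ha : 0 < a) :
    ∃ c, 0 ≤ c ∧ ∀ r ∈ Icc a b, GlobalSlopeLE D Q lam c (W r) := by
  obtain ⟨c, hc, hG⟩ := h.exists_globalSlopeLE hQ hP (half_pos ha)
  -- The bound is propagated from the single time `a / 2`; the exponential covers either sign of
  -- `lam`.
  refine ⟨Real.exp (|lam| * b) * c, by positivity, fun r hr => ?_⟩
  have har : a / 2 < r := by linarith [hr.1]
  refine (h.globalSlopeLE_exp hQ (half_pos ha).le
    (h.continuousOn.continuousAt (Ioi_mem_nhds (half_pos ha))).continuousWithinAt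
    (h.mem _ (half_pos ha)) hc hG.localSlopeLE har).mono ?_
  gcongr
  · exact neg_le_abs lam
  · linarith [hr.2]

theorem IsFlow.dist_le_mul_sub (h : IsFlow D Q lam W) {a b c : ℝ} (ha : 0 < a) (hc : 0 ≤ c)
    (hsl : ∀ r ∈ Icc a b, GlobalSlopeLE D Q lam c (W r)) {s t : ℝ} (hs : s ∈ Icc a b)
    (ht : t ∈ Icc a b) (hst : s ≤ t) : dist (W t) (W s) ≤ c * (t - s) := by
  have hr0 : ∀ r ∈ Icc s t, 0 < r := fun r hr => ha.trans_le (hs.1.trans hr.1)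
  refine image_le_of_liminf_slope_right_le_deriv_boundary (f := fun r => dist (W r) (W s))
    (B := fun x => c * (x - s)) (B' := fun _ => c) (a := s) (b := t)
    (continuousOn_dist (h.continuousOn.mono hr0) continuousOn_const) (by simp) (by fun_prop) ?_ ?_
    (right_mem_Icc.2 hst)
  · intro x _
    simpa using (((hasDerivAt_id x).sub_const s).const_mul c).hasDerivWithinAt
  · intro x hx m hm
    have hx0 := hr0 x ⟨hx.1, hx.2.le⟩
    obtain ⟨m', hm1, hm2⟩ := exists_between hm
    have hcx : ContinuousWithinAt W (Ioi x) x :=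
      (h.continuousOn.continuousAt (Ioi_mem_nhds hx0)).continuousWithinAt
    refine Eventually.frequently ?_
    filter_upwards [h.eventually_dist_le hx0.le hcx (h.mem x hx0) hc
      (hsl x ⟨hs.1.trans hx.1, hx.2.le.trans ht.2⟩).localSlopeLE hm1, self_mem_nhdsWithin]
      with r h1 h2
    rw [slope_def_field, div_lt_iff₀ (sub_pos.2 h2)]
    have h3 := mul_lt_mul_of_pos_right hm2 (sub_pos.2 h2)
    linarith [dist_triangle (W r) (W x) (W s)]

end Abstract

/-! ### From the saddle functional to a gap on the `ℓ²` product. -/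

noncomputable section

section Gap

variable {X Y : Type*} {φ : X → Y → EReal}

theorem coe_toReal {x : X} {y : Y} (hx : x ∈ domX φ)
    (hy : y ∈ domY φ) :
    ((φ x y).toReal : EReal) = φ x y :=
  EReal.coe_toReal (hx y).ne (hy x).ne'

/-- The effective domain as a subset of the `ℓ²` product. -/
def gapDom (φ : X → Y → EReal) : Set (WithLp 2 (X × Y)) := {p | p.ofLp ∈ dom φ}

/-- The real-valued gap `φ(x, y') - φ(x', y)` on the `ℓ²` product. -/
def gap (φ : X → Y → EReal) (p q : WithLp 2 (X × Y)) : ℝ :=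
  (φ p.ofLp.1 q.ofLp.2).toReal - (φ q.ofLp.1 p.ofLp.2).toReal

theorem sub_eq_gap {p q : WithLp 2 (X × Y)} (hp : p ∈ gapDom φ) (hq : q ∈ gapDom φ) :
    φ p.ofLp.1 q.ofLp.2 - φ q.ofLp.1 p.ofLp.2 = (gap φ p q : EReal) := by
  rw [gap, EReal.coe_sub, coe_toReal hp.1 hq.2, coe_toReal hq.1 hp.2]

end Gap

section Concrete

variable {X Y : Type*} [MetricSpace X] [MetricSpace Y] {φ : X → Y → EReal} {lam : ℝ}

theorem dist_eq_dZ (p q : WithLp 2 (X × Y)) : dist p q = dZ p.ofLp q.ofLp := by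
  rw [WithLp.prod_dist_eq_add (by norm_num), dZ, Real.sqrt_eq_rpow]
  simp

theorem dist_sq_eq (p q : WithLp 2 (X × Y)) :
    dist p q ^ 2 = dist p.ofLp.1 q.ofLp.1 ^ 2 + dist p.ofLp.2 q.ofLp.2 ^ 2 := by
  rw [dist_eq_dZ, dZ, Real.sq_sqrt (by positivity)]

theorem dist_fst_le (p q : WithLp 2 (X × Y)) : dist p.ofLp.1 q.ofLp.1 ≤ dist p q :=
  le_of_sq_le_sq (by rw [dist_sq_eq]; nlinarith) dist_nonneg

theorem dist_snd_le (p q : WithLp 2 (X × Y)) : dist p.ofLp.2 q.ofLp.2 ≤ dist p q :=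
  le_of_sq_le_sq (by rw [dist_sq_eq]; nlinarith) dist_nonneg

theorem eventually_gapDom_iff {z : X × Y} {P : WithLp 2 (X × Y) → Prop} :
    (∀ᶠ p in 𝓝[gapDom φ] (WithLp.toLp 2 z), P p)
      ↔ ∀ᶠ z' in 𝓝[dom φ] z, P (WithLp.toLp 2 z') := by
  rw [eventually_nhdsWithin_iff, eventually_nhdsWithin_iff,
    show WithLp.toLp 2 z = (WithLp.homeomorphProd 2 X Y).symm z from rfl,
    ← (WithLp.homeomorphProd 2 X Y).symm.map_nhds_eq, eventually_map]
  rfl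

theorem isGap (hφ : IsClosedFunctional φ) : IsGap (gapDom φ) (gap φ) where
  antisymm p _ q _ := by simp [gap]
  usc p hp q hq b hb := by
    simp only [gap] at hb
    set e := b - ((φ p.ofLp.1 q.ofLp.2).toReal - (φ q.ofLp.1 p.ofLp.2).toReal) with he
    have h1 : φ p.ofLp.1 q.ofLp.2 < (((φ p.ofLp.1 q.ofLp.2).toReal + e / 2 : ℝ) : EReal) := by
      conv_lhs => rw [← coe_toReal hp.1 hq.2]
      exact_mod_cast (by linarith)
    have h2 : (((φ q.ofLp.1 p.ofLp.2).toReal - e / 2 : ℝ) : EReal) < φ q.ofLp.1 p.ofLp.2 := by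
      conv_rhs => rw [← coe_toReal hq.1 hp.2]
      exact_mod_cast (by linarith)
    have c1 : Tendsto (fun r : WithLp 2 (X × Y) => r.ofLp.2) (𝓝[gapDom φ] q) (𝓝 q.ofLp.2) :=
      ((continuous_snd.comp (WithLp.prod_continuous_ofLp 2 X Y)).tendsto q).mono_left
        nhdsWithin_le_nhds
    have c2 : Tendsto (fun r : WithLp 2 (X × Y) => r.ofLp.1) (𝓝[gapDom φ] q) (𝓝 q.ofLp.1) :=
      ((continuous_fst.comp (WithLp.prod_continuous_ofLp 2 X Y)).tendsto q).mono_left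
        nhdsWithin_le_nhds
    filter_upwards [self_mem_nhdsWithin, c1.eventually (hφ.1 _ hp.1 _ _ h1),
      c2.eventually (hφ.2 _ hp.2 _ _ h2)] with r hr k1 k2
    rw [← coe_toReal hp.1 hr.2, EReal.coe_lt_coe_iff] at k1
    rw [← coe_toReal hr.1 hp.2, gt_iff_lt, EReal.coe_lt_coe_iff] at k2
    simp only [gap]
    linarith

theorem rightSlopeLE_of_rightDini_le {f : ℝ → ℝ} {t a : ℝ} (h : rightDini f t ≤ (a : EReal)) :
    RightSlopeLE f t a := by
  intro r hr
  have h1 := eventually_lt_of_limsup_lt (h.trans_lt (EReal.coe_lt_coe_iff.2 hr))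
  have hT : Tendsto (fun s => s - t) (𝓝[>] t) (𝓝[>] 0) := by
    refine tendsto_nhdsWithin_iff.2 ⟨?_, ?_⟩
    · have : Tendsto (fun s => s - t) (𝓝 t) (𝓝 (t - t)) := Continuous.tendsto (by fun_prop) t
      rw [sub_self] at this
      exact this.mono_left nhdsWithin_le_nhds
    · filter_upwards [self_mem_nhdsWithin] with s hs
      simpa using hs
  filter_upwards [hT.eventually h1] with s hs
  rw [EReal.coe_lt_coe_iff] at hs
  simpa [slope_def_field] using hs

theorem le_of_half_mul_add_le {d : EReal} {a p q : ℝ}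
    (h : ((1 / 2 : ℝ) : EReal) * d + (a : EReal) + (p : EReal) ≤ q) :
    d ≤ ((2 * (q - p - a) : ℝ) : EReal) := by
  induction d with
  | bot => simp
  -- The right side is real, which excludes an infinite derivative.
  | top =>
    rw [EReal.coe_mul_top_of_pos (by norm_num)] at h
    simp at h
  | coe d => norm_cast at *; linarith

/-- In the sum of the two inequalities `φ(u, v)` cancels, and the squared distances add up to the
`ℓ²` one. -/
theorem IsSolution.isFlow {w : ℝ → X × Y} (h : IsSolution φ lam w) :
    IsFlow (gapDom φ) (gap φ) lam (fun t => WithLp.toLp 2 (w t)) where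
  continuousOn := (WithLp.prod_continuous_toLp 2 X Y).comp_continuousOn h.continuousOn
  mem := h.mem_dom
  evi t ht z hz := by
    have h1 := h.evi_fst t ht z.ofLp hz
    have h2 := h.evi_snd t ht z.ofLp hz
    have hw := h.mem_dom t ht
    rw [← coe_toReal hw.1 hw.2, ← coe_toReal hz.1 hw.2] at h1
    rw [← coe_toReal hw.1 hw.2, ← coe_toReal hw.1 hz.2] at h2
    have := (rightSlopeLE_of_rightDini_le (le_of_half_mul_add_le h1)).add
      (rightSlopeLE_of_rightDini_le (le_of_half_mul_add_le h2))
    simp only [dist_sq_eq]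
    convert this using 1
    simp only [gap]
    ring

theorem hasPotential {c : X × Y → ℝ} (hc : LocallyLipschitz c) (hφ : IsCouplingTerm φ c) :
    HasPotential (gapDom φ) (gap φ) := by
  obtain ⟨ψX, ψY, hX, hXl, hY, hYu, hsum⟩ := hφ
  have hfin : ∀ p ∈ gapDom φ, ψX p.ofLp.1 ≠ ⊤ ∧ ψY p.ofLp.2 ≠ ⊥ := by
    intro p hp
    have h1 := hsum p.ofLp.1 p.ofLp.2 hp
    rw [← coe_toReal hp.1 hp.2] at h1
    have h2 : ψY p.ofLp.2 ≠ ⊥ := fun hb => by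
      rw [hb, EReal.add_bot] at h1
      exact EReal.coe_ne_bot _ h1
    refine ⟨fun ht => ?_, h2⟩
    rw [ht, EReal.coe_add_top, EReal.top_add_of_ne_bot h2] at h1
    exact EReal.coe_ne_top _ h1
  have hreal : ∀ p ∈ gapDom φ, ∀ q ∈ gapDom φ, (φ p.ofLp.1 q.ofLp.2).toReal
      = c (p.ofLp.1, q.ofLp.2) + (ψX p.ofLp.1).toReal + (ψY q.ofLp.2).toReal := by
    intro p hp q hq
    rw [← EReal.coe_eq_coe_iff, coe_toReal hp.1 hq.2, EReal.coe_add, EReal.coe_add,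
      EReal.coe_toReal (hfin p hp).1 (hX _), EReal.coe_toReal (hY _) (hfin q hq).2]
    exact hsum _ _ ⟨hp.1, hq.2⟩
  refine ⟨fun p => (ψX p.ofLp.1).toReal - (ψY p.ofLp.2).toReal, ?_, ?_⟩
  · intro q hq b hb
    simp only at hb
    set e := (ψX q.ofLp.1).toReal - (ψY q.ofLp.2).toReal - b with he
    have h1 : (((ψX q.ofLp.1).toReal - e / 2 : ℝ) : EReal) < ψX q.ofLp.1 := by
      conv_rhs => rw [← EReal.coe_toReal (hfin q hq).1 (hX _)]
      exact_mod_cast (by linarith)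
    have h2 : ψY q.ofLp.2 < (((ψY q.ofLp.2).toReal + e / 2 : ℝ) : EReal) := by
      conv_lhs => rw [← EReal.coe_toReal (hY _) (hfin q hq).2]
      exact_mod_cast (by linarith)
    have c1 : Tendsto (fun r : WithLp 2 (X × Y) => r.ofLp.2) (𝓝[gapDom φ] q) (𝓝 q.ofLp.2) :=
      ((continuous_snd.comp (WithLp.prod_continuous_ofLp 2 X Y)).tendsto q).mono_left
        nhdsWithin_le_nhds
    have c2 : Tendsto (fun r : WithLp 2 (X × Y) => r.ofLp.1) (𝓝[gapDom φ] q) (𝓝 q.ofLp.1) :=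
      ((continuous_fst.comp (WithLp.prod_continuous_ofLp 2 X Y)).tendsto q).mono_left
        nhdsWithin_le_nhds
    filter_upwards [self_mem_nhdsWithin, c2.eventually (hXl _ _ h1),
      c1.eventually (hYu _ _ h2)] with r hr k1 k2
    rw [← EReal.coe_toReal (hfin r hr).1 (hX _), gt_iff_lt, EReal.coe_lt_coe_iff] at k1
    rw [← EReal.coe_toReal (hY _) (hfin r hr).2, EReal.coe_lt_coe_iff] at k2
    linarith
  · intro p hp
    obtain ⟨K, N, hN, hK⟩ := hc p.ofLp
    refine ⟨K, K.coe_nonneg, ?_⟩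
    have cF : Tendsto (fun r : WithLp 2 (X × Y) => r.ofLp) (𝓝[gapDom φ] p) (𝓝 p.ofLp) :=
      ((WithLp.prod_continuous_ofLp 2 X Y).tendsto p).mono_left nhdsWithin_le_nhds
    have n1 : Tendsto (fun r : WithLp 2 (X × Y) => (p.ofLp.1, r.ofLp.2)) (𝓝[gapDom φ] p)
        (𝓝 p.ofLp) := tendsto_const_nhds.prodMk_nhds ((continuous_snd.tendsto _).comp cF)
    have n2 : Tendsto (fun r : WithLp 2 (X × Y) => (r.ofLp.1, p.ofLp.2)) (𝓝[gapDom φ] p)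
        (𝓝 p.ofLp) := ((continuous_fst.tendsto _).comp cF).prodMk_nhds tendsto_const_nhds
    filter_upwards [self_mem_nhdsWithin, n1.eventually hN, n2.eventually hN] with r hr k1 k2
    have h2 : dist (p.ofLp.1, r.ofLp.2) (r.ofLp.1, p.ofLp.2) ≤ dist p r := by
      rw [Prod.dist_eq, dist_comm r.ofLp.2]
      exact max_le (dist_fst_le p r) (dist_snd_le p r)
    have h1 := (hK.dist_le_mul _ k1 _ k2).trans (mul_le_mul_of_nonneg_left h2 K.coe_nonneg)
    have h4 := le_abs_self (c (p.ofLp.1, r.ofLp.2) - c (r.ofLp.1, p.ofLp.2))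
    rw [Real.dist_eq] at h1
    rw [gap, hreal p hp r hr, hreal r hr p hp]
    linarith

theorem gap_div_le_iff {z z' : X × Y} {c : ℝ} (hc : 0 ≤ c) (hz : z ∈ dom φ)
    (hz' : z' ∈ dom φ \ {z}) :
    (φ z.1 z'.2 - φ z'.1 z.2).toENNReal / ENNReal.ofReal (dZ z' z) ≤ ENNReal.ofReal c
      ↔ gap φ (WithLp.toLp 2 z) (WithLp.toLp 2 z')
        ≤ c * dist (WithLp.toLp 2 z) (WithLp.toLp 2 z') := by
  have hne : WithLp.toLp 2 z' ≠ WithLp.toLp 2 z := fun h => hz'.2 (WithLp.toLp_injective 2 h)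
  have hd : 0 < dist (WithLp.toLp 2 z') (WithLp.toLp 2 z) := dist_pos.2 hne
  have hg : φ z.1 z'.2 - φ z'.1 z.2 = (gap φ (WithLp.toLp 2 z) (WithLp.toLp 2 z') : EReal) :=
    sub_eq_gap (p := WithLp.toLp 2 z) (q := WithLp.toLp 2 z') hz hz'.1
  have hdZ : dZ z' z = dist (WithLp.toLp 2 z') (WithLp.toLp 2 z) := (dist_eq_dZ _ _).symm
  rw [hg, hdZ, EReal.real_coe_toENNReal, ← ENNReal.ofReal_div_of_pos hd,
    ENNReal.ofReal_le_ofReal_iff hc, div_le_iff₀ hd, dist_comm]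

theorem localSlope_le_iff {z : X × Y} {c : ℝ} (hc : 0 ≤ c) (hz : z ∈ dom φ) :
    localSlope φ z ≤ ENNReal.ofReal c
      ↔ LocalSlopeLE (gapDom φ) (gap φ) c (WithLp.toLp 2 z) := by
  rw [localSlope, if_pos hz]
  constructor
  · intro h c' hc'
    have hc0 : 0 < c' := hc.trans_lt hc'
    have h1 := eventually_lt_of_limsup_lt
      (h.trans_lt ((ENNReal.ofReal_lt_ofReal_iff hc0).2 hc'))
    rw [eventually_gapDom_iff]
    rw [eventually_nhdsWithin_iff] at h1 ⊢
    filter_upwards [h1] with z' h2 hz'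
    -- The slope omits `z' = z`; there the gap vanishes and the real inequality is trivial.
    rcases eq_or_ne z' z with rfl | hne
    · simp [gap]
    · exact (gap_div_le_iff hc0.le hz ⟨hz', hne⟩).1 (h2 ⟨hz', hne⟩).le
  · intro h
    have hT : Tendsto ENNReal.ofReal (𝓝[>] c) (𝓝 (ENNReal.ofReal c)) :=
      (ENNReal.continuous_ofReal.tendsto c).mono_left nhdsWithin_le_nhds
    refine ge_of_tendsto hT ?_
    filter_upwards [self_mem_nhdsWithin] with c' hc'
    have h1 := h c' hc'
    rw [eventually_gapDom_iff, eventually_nhdsWithin_iff] at h1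
    refine limsup_le_of_le (by isBoundedDefault) ?_
    rw [eventually_nhdsWithin_iff]
    filter_upwards [h1] with z' h2 hz'
    exact (gap_div_le_iff (hc.trans (le_of_lt hc')) hz hz').2 (h2 hz'.1)

theorem globalSlope_le_iff {z : X × Y} {c : ℝ} (hc : 0 ≤ c) (hz : z ∈ dom φ) :
    globalSlope φ lam z ≤ ENNReal.ofReal c
      ↔ GlobalSlopeLE (gapDom φ) (gap φ) lam c (WithLp.toLp 2 z) := by
  rw [globalSlope, if_pos hz]
  have key : ∀ z' ∈ dom φ \ {z},
      (((φ z.1 z'.2 - φ z'.1 z.2) / ((dZ z' z : ℝ) : EReal)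
        + ((lam / 2 * dZ z' z : ℝ) : EReal)).toENNReal ≤ ENNReal.ofReal c
      ↔ gap φ (WithLp.toLp 2 z) (WithLp.toLp 2 z')
        ≤ c * dist (WithLp.toLp 2 z) (WithLp.toLp 2 z')
          - lam / 2 * dist (WithLp.toLp 2 z) (WithLp.toLp 2 z') ^ 2) := by
    intro z' hz'
    have hne : WithLp.toLp 2 z' ≠ WithLp.toLp 2 z := fun h => hz'.2 (WithLp.toLp_injective 2 h)
    have hd : 0 < dist (WithLp.toLp 2 z') (WithLp.toLp 2 z) := dist_pos.2 hne
    have hg : φ z.1 z'.2 - φ z'.1 z.2 = (gap φ (WithLp.toLp 2 z) (WithLp.toLp 2 z') : EReal) :=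
      sub_eq_gap (p := WithLp.toLp 2 z) (q := WithLp.toLp 2 z') hz hz'.1
    have hdZ : dZ z' z = dist (WithLp.toLp 2 z') (WithLp.toLp 2 z) := (dist_eq_dZ _ _).symm
    rw [hg, hdZ, ← EReal.coe_div, ← EReal.coe_add, EReal.real_coe_toENNReal,
      ENNReal.ofReal_le_ofReal_iff hc, ← le_sub_iff_add_le, div_le_iff₀ hd, dist_comm]
    ring_nf
  simp only [iSup_le_iff]
  constructor
  · intro h p hp
    rcases eq_or_ne p (WithLp.toLp 2 z) with rfl | hne
    · simp [gap]
    · have hp' : p.ofLp ∈ dom φ \ {z} := ⟨hp, fun h' => hne (by rw [← h'])⟩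
      exact (key p.ofLp hp').1 (h p.ofLp hp')
  · intro h z' hz'
    exact (key z' hz').2 (h _ hz'.1)

/-- The limit point of a curve along which the slope is bounded belongs to the domain. -/
theorem mem_dom_of_globalSlopeLE (hproper : IsProper φ) (hφ : IsClosedFunctional φ)
    (hext : HasStandardExtension φ) {ι : Type*} {l : Filter ι} [l.NeBot] {ζ : ι → X × Y}
    {γ : ι → ℝ} {z : X × Y} {c : ℝ} (hζ : Tendsto ζ l (𝓝 z)) (hζD : ∀ᶠ i in l, ζ i ∈ dom φ)
    (hγ : Tendsto γ l (𝓝 c))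
    (h : ∀ᶠ i in l, GlobalSlopeLE (gapDom φ) (gap φ) lam (γ i) (WithLp.toLp 2 (ζ i))) :
    z ∈ dom φ := by
  obtain ⟨⟨x', y'⟩, hx', hy'⟩ := hproper
  simp only at hx' hy'
  set e := WithLp.toLp 2 (x', y') with he
  have heD : e ∈ gapDom φ := ⟨hx', hy'⟩
  have hd : Tendsto (fun i => γ i * dist (WithLp.toLp 2 (ζ i)) e
      - lam / 2 * dist (WithLp.toLp 2 (ζ i)) e ^ 2) l
      (𝓝 (c * dist (WithLp.toLp 2 z) e - lam / 2 * dist (WithLp.toLp 2 z) e ^ 2)) := by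
    have := (((WithLp.prod_continuous_toLp 2 X Y).tendsto z).comp hζ).dist
      (tendsto_const_nhds (x := e))
    exact (hγ.mul this).sub ((this.pow 2).const_mul _)
  set B := c * dist (WithLp.toLp 2 z) e - lam / 2 * dist (WithLp.toLp 2 z) e ^ 2 + 1 with hB
  -- Semicontinuity carries the slope inequality, tested at one fixed domain point, to the limit. If
  -- `z` were outside the domain, the extension values `⊤` or `⊥` would make `m - m'` arbitrarily
  -- large.
  have key : ∀ m m' : ℝ, (m : EReal) < φ z.1 y' → φ x' z.2 < (m' : EReal) → m - m' ≤ B := by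
    intro m m' hm hm'
    obtain ⟨i, h1, h2, h3, h4, h5⟩ := (h.and (hζD.and ((hd.eventually
      (gt_mem_nhds (lt_add_one _))).and ((((continuous_fst.tendsto z).comp hζ).eventually
        (hφ.2 y' hy' _ _ hm)).and (((continuous_snd.tendsto z).comp hζ).eventually
        (hφ.1 x' hx' _ _ hm')))))).exists
    have h6 := h1 e heD
    simp only [Function.comp] at h4 h5
    rw [← coe_toReal h2.1 hy', gt_iff_lt, EReal.coe_lt_coe_iff] at h4
    rw [← coe_toReal hx' h2.2, EReal.coe_lt_coe_iff] at h5
    simp only [gap, he] at h6 h3 hB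
    linarith
  by_contra hz
  by_cases hu : z.1 ∈ domX φ
  · have hv : z.2 ∉ domY φ := fun hv => hz ⟨hu, hv⟩
    obtain ⟨m, _, hm⟩ := EReal.lt_iff_exists_real_btwn.1 (hy' z.1)
    have := key m (m - B - 1) hm (by rw [hext.2 x' hx' _ hv]; exact EReal.bot_lt_coe _)
    linarith
  · obtain ⟨m', hm', _⟩ := EReal.lt_iff_exists_real_btwn.1 (hx' z.2)
    have := key (B + m' + 1) m' (by rw [hext.1 _ hu y' hy']; exact EReal.coe_lt_top _) hm'
    linarith

end Concrete

/-! ### Speed, slope and duality gap along solutions. -/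

section Solutions

variable {X Y : Type*} [MetricSpace X] [MetricSpace Y] {φ : X → Y → EReal} {lam : ℝ}
  {w : ℝ → X × Y}

theorem timeDomain_nonneg {s : ℝ} (hs : s ∈ timeDomain w) : 0 ≤ s := by
  rcases hs with h | h
  · exact h.le
  · exact h.1.ge

theorem IsSolution.tendsto_right (h : IsSolution φ lam w) {s : ℝ} (hs : s ∈ timeDomain w) :
    Tendsto w (𝓝[>] s) (𝓝 (w s)) := by
  rcases hs with hs | ⟨rfl, hs⟩
  · exact (h.continuousOn.continuousAt (Ioi_mem_nhds hs)).mono_left nhdsWithin_le_nhds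
  · exact hs

theorem IsSolution.tendsto_toLp (h : IsSolution φ lam w) {s : ℝ} (hs : s ∈ timeDomain w) :
    Tendsto (fun t => WithLp.toLp 2 (w t)) (𝓝[>] s) (𝓝 (WithLp.toLp 2 (w s))) :=
  ((WithLp.prod_continuous_toLp 2 X Y).tendsto _).comp (h.tendsto_right hs)

theorem IsSolution.exists_speed (hφ : IsClosedFunctional φ)
    (hP : HasPotential (gapDom φ) (gap φ)) (h : IsSolution φ lam w) {t : ℝ} (ht : 0 < t) :
    ∃ d : ℝ, 0 ≤ d ∧ Tendsto (fun s => dZ (w t) (w s) / |t - s|) (𝓝[>] t) (𝓝 d) ∧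
      localSlope φ (w t) = ENNReal.ofReal d ∧ globalSlope φ lam (w t) = ENNReal.ofReal d := by
  have hF := h.isFlow
  have hQ := isGap hφ
  have hwt := h.mem_dom t ht
  have hct := h.tendsto_toLp (Or.inl ht)
  obtain ⟨c, hc, hG⟩ := hF.exists_globalSlopeLE hQ hP ht
  have hfin : globalSlope φ lam (w t) ≠ ⊤ :=
    (((globalSlope_le_iff hc hwt).2 hG).trans_lt ENNReal.ofReal_lt_top).ne
  set d := (globalSlope φ lam (w t)).toReal with hd
  have hd0 : 0 ≤ d := ENNReal.toReal_nonneg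
  have hgd : globalSlope φ lam (w t) = ENNReal.ofReal d := (ENNReal.ofReal_toReal hfin).symm
  have hGd := (globalSlope_le_iff hd0 hwt).1 hgd.le
  have hle := (localSlope_le_iff hd0 hwt).2 hGd.localSlopeLE
  have hdist : ∀ s, dZ (w t) (w s) = dist (WithLp.toLp 2 (w s)) (WithLp.toLp 2 (w t)) :=
    fun s => by rw [dist_comm, dist_eq_dZ]
  refine ⟨d, hd0, tendsto_order.2 ⟨fun a had => ?_, fun a had => ?_⟩, ?_, hgd⟩
  · by_contra hcon
    have hfr : ∃ᶠ s in 𝓝[>] t, dist (WithLp.toLp 2 (w s)) (WithLp.toLp 2 (w t)) ≤ a * (s - t) := by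
      refine (Filter.not_eventually.1 hcon |>.and_eventually self_mem_nhdsWithin).mono ?_
      rintro s ⟨h1, h2⟩
      rw [not_lt, hdist, abs_sub_comm, abs_of_pos (sub_pos.2 h2), div_le_iff₀ (sub_pos.2 h2)] at h1
      exact h1
    have ha : 0 ≤ a := by
      obtain ⟨s, h1, h2⟩ := (hfr.and_eventually self_mem_nhdsWithin).exists
      exact nonneg_of_mul_nonneg_left (dist_nonneg.trans h1) (sub_pos.2 h2)
    have := (globalSlope_le_iff ha hwt).2 (hF.globalSlopeLE hQ ht hfr)
    rw [hgd, ENNReal.ofReal_le_ofReal_iff ha] at this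
    linarith
  · obtain ⟨m, hm1, hm2⟩ := exists_between had
    filter_upwards [self_mem_nhdsWithin, hF.eventually_dist_le ht.le hct hwt hd0
      hGd.localSlopeLE hm1] with s h2 h1
    rw [hdist, abs_sub_comm, abs_of_pos (sub_pos.2 h2)]
    exact ((div_le_iff₀ (sub_pos.2 h2)).2 h1).trans_lt hm2
  · refine le_antisymm hle ?_
    have hl := ENNReal.ofReal_toReal (hle.trans_lt ENNReal.ofReal_lt_top).ne
    have hl0 : 0 ≤ (localSlope φ (w t)).toReal := ENNReal.toReal_nonneg
    rw [← hgd, ← hl, globalSlope_le_iff hl0 hwt]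
    refine .of_forall_lt fun m hm => hF.globalSlopeLE hQ ht (Eventually.frequently ?_)
    exact hF.eventually_dist_le ht.le hct hwt hl0 ((localSlope_le_iff hl0 hwt).1 hl.ge) hm

theorem IsSolution.localSlope_le_exp_mul (hφ : IsClosedFunctional φ) (h : IsSolution φ lam w)
    {s t : ℝ} (hs : s ∈ timeDomain w) (hst : s < t) :
    localSlope φ (w t) ≤ ENNReal.ofReal (Real.exp (-lam * (t - s))) * localSlope φ (w s) := by
  have hs0 := timeDomain_nonneg hs
  by_cases htop : localSlope φ (w s) = ⊤
  · rw [htop, ENNReal.mul_top (by simp [Real.exp_pos])]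
    exact le_top
  have hws : w s ∈ dom φ := by
    by_contra hcon
    exact htop (if_neg hcon)
  have hl := ENNReal.ofReal_toReal htop
  have hl0 : 0 ≤ (localSlope φ (w s)).toReal := ENNReal.toReal_nonneg
  have hG := h.isFlow.globalSlopeLE_exp (isGap hφ) hs0 (h.tendsto_toLp hs) hws hl0
    ((localSlope_le_iff hl0 hws).1 hl.ge) hst
  have := (localSlope_le_iff (by positivity) (h.mem_dom t (hs0.trans_lt hst))).2 hG.localSlopeLE
  rwa [ENNReal.ofReal_mul (Real.exp_pos _).le, hl] at this

theorem IsSolution.antitoneOn_exp_mul_localSlope (hφ : IsClosedFunctional φ)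
    (h : IsSolution φ lam w) :
    AntitoneOn (fun t => ENNReal.ofReal (Real.exp (lam * t)) * localSlope φ (w t))
      (timeDomain w) := by
  intro s hs t _ hst
  rcases hst.eq_or_lt with rfl | hst
  · exact le_rfl
  calc ENNReal.ofReal (Real.exp (lam * t)) * localSlope φ (w t)
      ≤ ENNReal.ofReal (Real.exp (lam * t)) *
        (ENNReal.ofReal (Real.exp (-lam * (t - s))) * localSlope φ (w s)) := by
        gcongr
        exact h.localSlope_le_exp_mul hφ hs hst
    _ = ENNReal.ofReal (Real.exp (lam * s)) * localSlope φ (w s) := by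
        rw [← mul_assoc, ← ENNReal.ofReal_mul (Real.exp_pos _).le, ← Real.exp_add]
        ring_nf

theorem IsSolution.continuousWithinAt_exp_mul_localSlope (hproper : IsProper φ)
    (hφ : IsClosedFunctional φ) (hext : HasStandardExtension φ)
    (hP : HasPotential (gapDom φ) (gap φ)) (h : IsSolution φ lam w) {t : ℝ}
    (ht : t ∈ timeDomain w) :
    ContinuousWithinAt (fun r => ENNReal.ofReal (Real.exp (lam * r)) * localSlope φ (w r))
      (Ici t) t := by
  have hanti := h.antitoneOn_exp_mul_localSlope hφ
  have ht0 := timeDomain_nonneg ht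
  have hmem : ∀ r, t < r → r ∈ timeDomain w := fun r hr => Or.inl (ht0.trans_lt hr)
  rw [← continuousWithinAt_Ioi_iff_Ici]
  refine tendsto_order.2 ⟨fun a hat => ?_, fun a hat => ?_⟩
  · by_contra hcon
    -- Monotonicity upgrades the bound from a sequence of times to all `r > t`. Its limit at `t`
    -- first places `w t` in the domain, which is not known when `t = 0`, and then bounds its slope
    -- by `a`.
    have hle : ∀ r, t < r →
        ENNReal.ofReal (Real.exp (lam * r)) * localSlope φ (w r) ≤ a := by
      intro r hr
      obtain ⟨q, h1, h2⟩ := ((Filter.not_eventually.1 hcon).and_eventually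
        (Ioo_mem_nhdsGT hr)).exists
      exact (hanti (hmem q h2.1) (hmem r hr) h2.2.le).trans (not_lt.1 h1)
    have hl := ENNReal.ofReal_toReal hat.ne_top
    have hl0 : 0 ≤ a.toReal := ENNReal.toReal_nonneg
    have hG : ∀ r, t < r → GlobalSlopeLE (gapDom φ) (gap φ) lam
        (Real.exp (-(lam * r)) * a.toReal) (WithLp.toLp 2 (w r)) := by
      intro r hr
      have hr0 := ht0.trans_lt hr
      obtain ⟨d, _, _, h1, h2⟩ := h.exists_speed hφ hP hr0
      rw [← globalSlope_le_iff (by positivity) (h.mem_dom r hr0), h2, ← h1,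
        ENNReal.ofReal_mul (Real.exp_pos _).le, hl]
      calc localSlope φ (w r) = ENNReal.ofReal (Real.exp (-(lam * r))) *
            (ENNReal.ofReal (Real.exp (lam * r)) * localSlope φ (w r)) := by
            rw [← mul_assoc, ← ENNReal.ofReal_mul (Real.exp_pos _).le, ← Real.exp_add]
            simp
        _ ≤ _ := by gcongr; exact hle r hr
    have hγ : Tendsto (fun r => Real.exp (-(lam * r)) * a.toReal) (𝓝[>] t)
        (𝓝 (Real.exp (-(lam * t)) * a.toReal)) :=
      (Continuous.tendsto (by fun_prop) t).mono_left nhdsWithin_le_nhds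
    have hGev : ∀ᶠ r in 𝓝[>] t, GlobalSlopeLE (gapDom φ) (gap φ) lam
        (Real.exp (-(lam * r)) * a.toReal) (WithLp.toLp 2 (w r)) := by
      filter_upwards [self_mem_nhdsWithin] with r hr using hG r hr
    have hDev : ∀ᶠ r in 𝓝[>] t, w r ∈ dom φ := by
      filter_upwards [self_mem_nhdsWithin] with r hr using h.mem_dom r (ht0.trans_lt hr)
    have hwt : w t ∈ dom φ := mem_dom_of_globalSlopeLE hproper hφ hext (h.tendsto_right ht)
      hDev hγ hGev
    have hGt := GlobalSlopeLE.of_tendsto (isGap hφ) hwt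
      (tendsto_nhdsWithin_iff.2 ⟨h.tendsto_toLp ht, hDev⟩) hγ hGev
    have := (localSlope_le_iff (by positivity) hwt).2 hGt.localSlopeLE
    rw [ENNReal.ofReal_mul (Real.exp_pos _).le, hl] at this
    refine hat.not_ge ?_
    calc ENNReal.ofReal (Real.exp (lam * t)) * localSlope φ (w t)
        ≤ ENNReal.ofReal (Real.exp (lam * t)) * (ENNReal.ofReal (Real.exp (-(lam * t))) * a) := by
          gcongr
      _ = a := by
          rw [← mul_assoc, ← ENNReal.ofReal_mul (Real.exp_pos _).le, ← Real.exp_add]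
          simp
  · filter_upwards [self_mem_nhdsWithin] with r hr
    exact (hanti ht (hmem r hr) (le_of_lt hr)).trans_lt hat

theorem IsSolution.exists_dist_le (hφ : IsClosedFunctional φ)
    (hP : HasPotential (gapDom φ) (gap φ)) (h : IsSolution φ lam w) {a b : ℝ} (ha : 0 < a) :
    ∃ c, 0 ≤ c ∧ (∀ r ∈ Icc a b, GlobalSlopeLE (gapDom φ) (gap φ) lam c (WithLp.toLp 2 (w r))) ∧
      ∀ s ∈ Icc a b, ∀ t ∈ Icc a b,
        dist (WithLp.toLp 2 (w s)) (WithLp.toLp 2 (w t)) ≤ c * |s - t| := by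
  obtain ⟨c, hc, hG⟩ := h.isFlow.exists_globalSlopeLE_Icc (isGap hφ) hP (b := b) ha
  refine ⟨c, hc, hG, fun s hs t ht => ?_⟩
  rcases le_total s t with hst | hst
  · rw [dist_comm, abs_sub_comm, abs_of_nonneg (sub_nonneg.2 hst)]
    exact h.isFlow.dist_le_mul_sub ha hc hG hs ht hst
  · rw [abs_of_nonneg (sub_nonneg.2 hst)]
    exact h.isFlow.dist_le_mul_sub ha hc hG ht hs hst

theorem locallyLipschitzOn_Ioi {α : Type*} [PseudoMetricSpace α] {f : ℝ → α}
    (hf : ∀ a b : ℝ, 0 < a → ∃ c, 0 ≤ c ∧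
      ∀ s ∈ Icc a b, ∀ t ∈ Icc a b, dist (f s) (f t) ≤ c * |s - t|) :
    LocallyLipschitzOn (Ioi 0) f := by
  intro t ht
  have ht' : 0 < t := ht
  obtain ⟨c, hc, hf⟩ := hf (t / 2) (2 * t) (half_pos ht')
  refine ⟨⟨c, hc⟩, Icc (t / 2) (2 * t),
    mem_nhdsWithin_of_mem_nhds (Icc_mem_nhds (by linarith) (by linarith)), ?_⟩
  exact LipschitzOnWith.of_dist_le_mul fun s hs r hr => hf s hs r hr

theorem IsSolution.locallyLipschitzOn (hφ : IsClosedFunctional φ)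
    (hP : HasPotential (gapDom φ) (gap φ)) (h : IsSolution φ lam w) :
    LocallyLipschitzOn (Ioi 0) w := by
  refine locallyLipschitzOn_Ioi fun a b ha => ?_
  obtain ⟨c, hc, _, hd⟩ := h.exists_dist_le hφ hP (b := b) ha
  refine ⟨c, hc, fun s hs t ht => le_trans ?_ (hd s hs t ht)⟩
  rw [Prod.dist_eq]
  exact max_le (dist_fst_le (WithLp.toLp 2 (w s)) (WithLp.toLp 2 (w t)))
    (dist_snd_le (WithLp.toLp 2 (w s)) (WithLp.toLp 2 (w t)))

theorem IsSolution.locallyLipschitzOn_value (hφ : IsClosedFunctional φ)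
    (hP : HasPotential (gapDom φ) (gap φ)) (h : IsSolution φ lam w) :
    LocallyLipschitzOn (Ioi 0) (fun t => (φ (w t).1 (w t).2).toReal) := by
  refine locallyLipschitzOn_Ioi fun a b ha => ?_
  obtain ⟨c, hc, hG, hd⟩ := h.exists_dist_le hφ hP (b := b) ha
  set C := c + |lam| / 2 * (c * |b - a|) with hC
  have hC0 : 0 ≤ C := by positivity
  have key : ∀ s ∈ Icc a b, ∀ t ∈ Icc a b,
      (φ (w t).1 (w t).2).toReal - (φ (w s).1 (w s).2).toReal ≤ 2 * C * c * |s - t| := by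
    intro s hs t ht
    have hws := h.mem_dom s (ha.trans_le hs.1)
    have hwt := h.mem_dom t (ha.trans_le ht.1)
    set ρ := dist (WithLp.toLp 2 (w s)) (WithLp.toLp 2 (w t)) with hρ
    have hρ1 : ρ ≤ c * |s - t| := hd s hs t ht
    have hρ2 : ρ ≤ c * |b - a| := by
      refine hρ1.trans (mul_le_mul_of_nonneg_left ?_ hc)
      rw [abs_of_nonneg (by linarith [hs.1, hs.2] : 0 ≤ b - a), abs_le]
      constructor <;> linarith [hs.1, hs.2, ht.1, ht.2]
    have quad : ∀ e, 0 ≤ e → e ≤ ρ → c * e - lam / 2 * e ^ 2 ≤ C * ρ := by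
      intro e he heρ
      have h1 : -(lam / 2 * e ^ 2) ≤ |lam| / 2 * (c * |b - a|) * e := by
        calc -(lam / 2 * e ^ 2) = -lam / 2 * e * e := by ring
          _ ≤ |lam| / 2 * (c * |b - a|) * e := by
            gcongr
            · exact neg_le_abs lam
            · exact heρ.trans hρ2
      have h2 := mul_le_mul_of_nonneg_left heρ hC0
      rw [hC] at h2 ⊢
      linarith
    -- At the mixed point `(u_s, v_t)` the gaps from `w t` and `w s` are `φ(u_t, v_t) - φ(u_s, v_t)`
    -- and `φ(u_s, v_t) - φ(u_s, v_s)`; their sum telescopes.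
    have h1 := hG t ht (WithLp.toLp 2 ((w s).1, (w t).2)) ⟨hws.1, hwt.2⟩
    have h2 := hG s hs (WithLp.toLp 2 ((w s).1, (w t).2)) ⟨hws.1, hwt.2⟩
    have e1 : dist (WithLp.toLp 2 (w t)) (WithLp.toLp 2 ((w s).1, (w t).2)) ≤ ρ := by
      refine le_of_sq_le_sq ?_ dist_nonneg
      rw [dist_sq_eq, hρ, dist_sq_eq, dist_comm (w s).1]
      simp
    have e2 : dist (WithLp.toLp 2 (w s)) (WithLp.toLp 2 ((w s).1, (w t).2)) ≤ ρ := by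
      refine le_of_sq_le_sq ?_ dist_nonneg
      rw [dist_sq_eq, hρ, dist_sq_eq]
      simp
    have q1 := h1.trans (quad _ dist_nonneg e1)
    have q2 := h2.trans (quad _ dist_nonneg e2)
    simp only [gap] at q1 q2
    have := mul_le_mul_of_nonneg_left hρ1 hC0
    linarith
  refine ⟨2 * C * c, by positivity, fun s hs t ht => ?_⟩
  rw [Real.dist_eq, abs_le]
  constructor
  · linarith [key s hs t ht]
  · have := key t ht s hs
    rwa [abs_sub_comm] at this

theorem dualityGap_le_of_globalSlopeLE (hext : HasStandardExtension φ) (hlam : 0 < lam) {c : ℝ}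
    {z : X × Y} (hz : z ∈ dom φ)
    (hG : GlobalSlopeLE (gapDom φ) (gap φ) lam c (WithLp.toLp 2 z)) :
    dualityGap φ z ≤ ((c ^ 2 / (2 * lam) : ℝ) : EReal) := by
  refine iSup_le fun z' => ?_
  by_cases h1 : z'.1 ∈ domX φ
  · by_cases h2 : z'.2 ∈ domY φ
    · have hz' : WithLp.toLp 2 z' ∈ gapDom φ := ⟨h1, h2⟩
      have hg : φ z.1 z'.2 - φ z'.1 z.2 = (gap φ (WithLp.toLp 2 z) (WithLp.toLp 2 z') : EReal) :=
        sub_eq_gap (p := WithLp.toLp 2 z) (q := WithLp.toLp 2 z') hz hz'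
      rw [hg, EReal.coe_le_coe_iff]
      refine (hG _ hz').trans ?_
      rw [le_div_iff₀ (by positivity)]
      nlinarith [sq_nonneg (c - lam * dist (WithLp.toLp 2 z) (WithLp.toLp 2 z'))]
    -- Competitors outside the domain contribute `⊥`, since in `EReal` both `⊥ - a` and `a - ⊤`
    -- equal `⊥` for every `a`.
    · rw [hext.2 _ hz.1 _ h2, EReal.bot_sub]
      exact bot_le
  · rw [hext.1 _ h1 _ hz.2, EReal.sub_top]
    exact bot_le

theorem IsSolution.dualityGap_le (hφ : IsClosedFunctional φ) (hext : HasStandardExtension φ)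
    (hP : HasPotential (gapDom φ) (gap φ)) (h : IsSolution φ lam w) (hlam : 0 < lam) {s t : ℝ}
    (hs : s ∈ timeDomain w) (hst : s < t) :
    dualityGap φ (w t) ≤ ((ENNReal.ofReal (Real.exp (-2 * lam * (t - s)) / (2 * lam))
      * localSlope φ (w s) ^ 2 : ℝ≥0∞) : EReal) := by
  have ht := (timeDomain_nonneg hs).trans_lt hst
  obtain ⟨d, hd, _, h1, h2⟩ := h.exists_speed hφ hP ht
  refine (dualityGap_le_of_globalSlopeLE hext hlam (h.mem_dom t ht)
    ((globalSlope_le_iff hd (h.mem_dom t ht)).1 h2.le)).trans ?_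
  have hle := h.localSlope_le_exp_mul hφ hs hst
  rw [h1] at hle
  have key : ENNReal.ofReal (d ^ 2 / (2 * lam))
      ≤ ENNReal.ofReal (Real.exp (-2 * lam * (t - s)) / (2 * lam)) * localSlope φ (w s) ^ 2 := by
    have hE : Real.exp (-2 * lam * (t - s)) = Real.exp (-lam * (t - s)) ^ 2 := by
      rw [← Real.exp_nat_mul]; push_cast; ring_nf
    rw [hE, div_eq_mul_inv, div_eq_mul_inv, ENNReal.ofReal_mul (by positivity),
      ENNReal.ofReal_mul (by positivity), ENNReal.ofReal_pow hd,
      ENNReal.ofReal_pow (Real.exp_pos _).le, mul_right_comm, ← mul_pow]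
    gcongr
  refine le_trans ?_ (EReal.coe_ennreal_le_coe_ennreal_iff.2 key)
  rw [EReal.coe_ennreal_ofReal, EReal.coe_le_coe_iff]
  exact le_max_left _ _

end Solutions

end

end EVIs

theorem mainTheorem3 {X Y : Type*} [MetricSpace X] [CompleteSpace X]
    [MetricSpace Y] [CompleteSpace Y] (φ : X → Y → EReal) (lam : ℝ)
    (hproper : EVIs.IsProper φ) (hclosed : EVIs.IsClosedFunctional φ)
    (hext : EVIs.HasStandardExtension φ) :
    ((∃ c : X × Y → ℝ, Continuous c ∧ EVIs.IsCouplingTerm φ c) →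
      -- contraction
      (∀ w₀ w₁ : ℝ → X × Y, EVIs.IsSolution φ lam w₀ → EVIs.IsSolution φ lam w₁ →
        ∀ s ∈ EVIs.timeDomain w₀ ∩ EVIs.timeDomain w₁, ∀ t, s < t →
          EVIs.dZ (w₀ t) (w₁ t) ^ 2
            ≤ Real.exp (-2 * lam * (t - s)) * EVIs.dZ (w₀ s) (w₁ s) ^ 2) ∧
      -- uniqueness
      (∀ z ∈ closure (EVIs.dom φ), ∀ w₀ w₁ : ℝ → X × Y,
        EVIs.IsSolution φ lam w₀ → EVIs.IsSolution φ lam w₁ →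
        Tendsto w₀ (𝓝[>] 0) (𝓝 z) → Tendsto w₁ (𝓝[>] 0) (𝓝 z) →
        ∀ t, 0 < t → w₀ t = w₁ t)) ∧
    ((∃ c : X × Y → ℝ, LocallyLipschitz c ∧ EVIs.IsCouplingTerm φ c) →
      ∀ w : ℝ → X × Y, EVIs.IsSolution φ lam w →
      -- right limits
      (∀ t, 0 < t → ∃ d : ℝ,
        Tendsto (fun s => EVIs.dZ (w t) (w s) / |t - s|) (𝓝[>] t) (𝓝 d) ∧
        EVIs.localSlope φ (w t) = ENNReal.ofReal d ∧
        EVIs.globalSlope φ lam (w t) = ENNReal.ofReal d) ∧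
      -- regularizing effects
      (∃ g : ℝ → ℝ, (∀ t, 0 < t → φ (w t).1 (w t).2 = (g t : EReal)) ∧
        LocallyLipschitzOn (Ioi 0) g) ∧
      LocallyLipschitzOn (Ioi 0) w ∧
      AntitoneOn (fun t => ENNReal.ofReal (Real.exp (lam * t)) * EVIs.localSlope φ (w t))
        (EVIs.timeDomain w) ∧
      (∀ t ∈ EVIs.timeDomain w, ContinuousWithinAt
        (fun r => ENNReal.ofReal (Real.exp (lam * r)) * EVIs.localSlope φ (w r)) (Ici t) t) ∧
      -- asymptotic behaviour
      (0 < lam → ∀ s ∈ EVIs.timeDomain w, ∀ t, s < t →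
        EVIs.dualityGap φ (w t)
          ≤ ((ENNReal.ofReal (Real.exp (-2 * lam * (t - s)) / (2 * lam))
              * EVIs.localSlope φ (w s) ^ 2 : ℝ≥0∞) : EReal))) := by
  refine ⟨fun _ => ⟨?_, ?_⟩, fun ⟨c, hc, hcφ⟩ w hw => ?_⟩
  · intro w₀ w₁ h₀ h₁ s hs t hst
    simpa [EVIs.dist_eq_dZ] using h₀.isFlow.contraction_of_tendsto (EVIs.isGap hclosed) h₁.isFlow
      (EVIs.timeDomain_nonneg hs.1) hst (h₀.tendsto_toLp hs.1) (h₁.tendsto_toLp hs.2)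
  · intro z _ w₀ w₁ h₀ h₁ hz₀ hz₁ t ht
    have hL := (WithLp.prod_continuous_toLp 2 X Y).tendsto z
    have := h₀.isFlow.contraction_of_tendsto (EVIs.isGap hclosed) h₁.isFlow le_rfl ht
      (hL.comp hz₀) (hL.comp hz₁)
    rw [dist_self, zero_pow two_ne_zero, mul_zero] at this
    exact WithLp.toLp_injective 2 (dist_eq_zero.1 (pow_eq_zero_iff two_ne_zero |>.1
      (this.antisymm (sq_nonneg _))))
  · have hP := EVIs.hasPotential hc hcφ
    refine ⟨fun t ht => ?_, ⟨fun t => (φ (w t).1 (w t).2).toReal, fun t ht => ?_, ?_⟩,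
      hw.locallyLipschitzOn hclosed hP, hw.antitoneOn_exp_mul_localSlope hclosed,
      fun t ht => hw.continuousWithinAt_exp_mul_localSlope hproper hclosed hext hP ht,
      fun hlam s hs t hst => hw.dualityGap_le hclosed hext hP hlam hs hst⟩
    · obtain ⟨d, _, h⟩ := hw.exists_speed hclosed hP ht
      exact ⟨d, h⟩
    · exact (EVIs.coe_toReal (hw.mem_dom t ht).1 (hw.mem_dom t ht).2).symm
    · exact hw.locallyLipschitzOn_value hclosed hP
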